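/- For $n\ge 1$ let $H_n^{\mathsf{fi}}$ be the number of subgroups of index $n$ of the modular group $\mathrm{PSL}_2(\mathbb{Z})=\mathrm{SL}_2(\mathbb{Z})/\{\pm I\}$. This number is finite for every $n\ge 1$, and as $n\to\infty$, $$H_n^{\mathsf{fi}} \sim \frac{e^{-\frac14}\,n^{\frac12}}{\sqrt{12\pi}}\; n^{\frac n6}\,\exp\left(-\frac n6+n^{\frac12}+n^{\frac13}\right),$$ where $u_n\sim v_n$ means that $u_n/v_n\to 1$. Equivalently, in Newman's form, $$H_n^{\mathsf{fi}} \sim \left(12\pi\, e^{\frac12}\right)^{-\frac12}\exp\left(\frac16\, n\log n-\frac16 n+n^{\frac12}+n^{\frac13}+\frac12\log n\right).$$ -/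

import Mathlib

open Finset Filter Topology

/-! The modular group is the free product of cyclic groups of orders 2 and 3 (ping-pong,
`ModularGroup.coprodEquiv`). A homomorphism to `S_n` is thus a pair of permutations with `a² = 1`
and `b³ = 1`, and the number `h_n` of homomorphisms is a product of two counts
(`permHomCount_modular`).

A subgroup of index `n` with labelled cosets is the same as a transitive homomorphism with a base
point. Counting both ways gives `n * t_n = n! * H_n` for the number `t_n` of transitive
homomorphisms (`mul_transitiveHomCount`). An intransitive homomorphism splits along an invariant
subset, so with `a_n = h_n / n!` the proportion of intransitive ones is at most `∑ a_k a_{n-k} /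
a_n` over `0 < k < n`. As `a_n` grows like `n^(n/6)` up to lower-order factors, this tends to 0
(`tendsto_sum_Ioo_mul_div`), and `H_n ~ n * a_n`.

It remains to count solutions of `σ^p = 1` for `p = 2, 3` (`tendsto_powOneCount_div`). Sorted by the
number `k` of fixed points, the count over `n!` is a sum of `1 / (k! p^j j!)` with `n = k + p j`.
Stirling's formula for `j!` turns this into an explicit scale times a Poisson average, with
parameter `n^(1/p)`, over the class `k ≡ n` mod `p`. The Poisson law equidistributes mod `p`, giving
a factor `1/p`, and concentrates at `k ~ n^(1/p)`, where the correction is about `exp(-k²/(2pn))`.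
Its limit is `e^(-1/4)` for `p = 2` and 1 for `p = 3`. -/

/-! ### The modular group as a free product of cyclic groups. -/

/-- Homomorphisms from the cyclic group of order `k` are the elements of order dividing `k`. -/
noncomputable def zmodHomEquiv (k : ℕ) (G : Type*) [Group G] :
    (Multiplicative (ZMod k) →* G) ≃ {g : G // g ^ k = 1} :=
  Equiv.ofBijective
    (fun φ => ⟨φ (Multiplicative.ofAdd 1), by
      rw [← map_pow, ← ofAdd_nsmul]; simp⟩)
    ⟨by
      intro φ ψ h
      have h1 : φ (Multiplicative.ofAdd 1) = ψ (Multiplicative.ofAdd 1) := congrArg Subtype.val h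
      refine MonoidHom.ext fun x => ?_
      obtain ⟨z, rfl⟩ := Multiplicative.ofAdd.surjective x
      obtain ⟨m, rfl⟩ := ZMod.intCast_surjective z
      have : (Multiplicative.ofAdd (m : ZMod k)) = (Multiplicative.ofAdd (1 : ZMod k)) ^ m := by
        rw [← ofAdd_zsmul]; simp
      rw [this, map_zpow, map_zpow, h1],
    by
      rintro ⟨g, hg⟩
      refine ⟨AddMonoidHom.toMultiplicativeLeft
        (ZMod.lift k ⟨zmultiplesHom (Additive G) (Additive.ofMul g), ?_⟩), ?_⟩
      · simpa using congrArg Additive.ofMul hg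
      · apply Subtype.ext
        have := ZMod.lift_coe k (⟨zmultiplesHom (Additive G) (Additive.ofMul g), by
          simpa using congrArg Additive.ofMul hg⟩ : {f : ℤ →+ Additive G // f k = 0}) 1
        simp only [Int.cast_one] at this
        exact (congrArg Additive.toMul this).trans (by simp)⟩

theorem zmodHomEquiv_apply (k : ℕ) (G : Type*) [Group G] (φ : Multiplicative (ZMod k) →* G) :
    (zmodHomEquiv k G φ : G) = φ (Multiplicative.ofAdd 1) := rfl

theorem zmodHomEquiv_symm_apply_ofAdd_one (k : ℕ) (G : Type*) [Group G]
    (g : {g : G // g ^ k = 1}) :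
    (zmodHomEquiv k G).symm g (Multiplicative.ofAdd 1) = g := by
  rw [← zmodHomEquiv_apply, Equiv.apply_symm_apply]

namespace ModularGroup

open Matrix Matrix.SpecialLinearGroup

/-- The action `M ↦ g M gᵀ` of `SL₂(ℤ)` on integral matrices, as a homomorphism to permutations. -/
def congruenceHom : SpecialLinearGroup (Fin 2) ℤ →* Equiv.Perm (Matrix (Fin 2) (Fin 2) ℤ) where
  toFun g :=
    { toFun := fun M => g.1 * M * g.1ᵀ
      invFun := fun M => (g⁻¹).1 * M * (g⁻¹).1ᵀ
      left_inv := fun M => by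
        have h : (g⁻¹ : SpecialLinearGroup (Fin 2) ℤ).1 * g.1 = 1 := by
          change ((g⁻¹ * g : SpecialLinearGroup (Fin 2) ℤ)).1 = 1
          rw [inv_mul_cancel]; rfl
        have h' : g.1ᵀ * (g⁻¹).1ᵀ = 1 := by rw [← transpose_mul, h, transpose_one]
        calc (g⁻¹).1 * (g.1 * M * g.1ᵀ) * (g⁻¹).1ᵀ
            = ((g⁻¹).1 * g.1) * M * (g.1ᵀ * (g⁻¹).1ᵀ) := by simp only [Matrix.mul_assoc]
          _ = M := by rw [h, h', Matrix.one_mul, Matrix.mul_one]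
      right_inv := fun M => by
        have h : g.1 * (g⁻¹ : SpecialLinearGroup (Fin 2) ℤ).1 = 1 := by
          change ((g * g⁻¹ : SpecialLinearGroup (Fin 2) ℤ)).1 = 1
          rw [mul_inv_cancel]; rfl
        have h' : (g⁻¹).1ᵀ * g.1ᵀ = 1 := by rw [← transpose_mul, h, transpose_one]
        calc g.1 * ((g⁻¹).1 * M * (g⁻¹).1ᵀ) * g.1ᵀ
            = (g.1 * (g⁻¹).1) * M * ((g⁻¹).1ᵀ * g.1ᵀ) := by simp only [Matrix.mul_assoc]
          _ = M := by rw [h, h', Matrix.one_mul, Matrix.mul_one] }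
  map_one' := by ext1 M; simp
  map_mul' g h := by
    ext1 M
    simp [Matrix.mul_assoc]

theorem congruenceHom_apply (g : SpecialLinearGroup (Fin 2) ℤ) (M : Matrix (Fin 2) (Fin 2) ℤ) :
    congruenceHom g M = g.1 * M * g.1ᵀ := rfl

/-- A central element is a scalar `r` with `r² = 1`, and it enters `g M gᵀ` twice. This is why
congruence, unlike the linear action on vectors, descends to the quotient by the center. -/
theorem congruenceHom_eq_one_of_mem_center {g : SpecialLinearGroup (Fin 2) ℤ}
    (hg : g ∈ Subgroup.center (SpecialLinearGroup (Fin 2) ℤ)) : congruenceHom g = 1 := by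
  obtain ⟨r, hr, hg⟩ := mem_center_iff.1 hg
  ext1 M
  rw [congruenceHom_apply, ← hg]
  have : r * r = 1 := by simpa [sq] using hr
  have hs : (scalar (Fin 2)) r = r • (1 : Matrix (Fin 2) (Fin 2) ℤ) := by
    rw [scalar_apply, Matrix.smul_one_eq_diagonal]
  simp only [hs, transpose_smul, transpose_one, Matrix.smul_mul, Matrix.mul_smul, Matrix.one_mul,
    Matrix.mul_one, smul_smul, this, one_smul, Equiv.Perm.one_apply]

/-- The action `M ↦ g M gᵀ` of the modular group. -/
noncomputable def projCongruenceHom :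
    ProjectiveSpecialLinearGroup (Fin 2) ℤ →* Equiv.Perm (Matrix (Fin 2) (Fin 2) ℤ) :=
  QuotientGroup.lift _ congruenceHom fun _ hg => congruenceHom_eq_one_of_mem_center hg

/-- The element `T * S` of order three in the modular group. -/
def U : SpecialLinearGroup (Fin 2) ℤ := ⟨!![1, -1; 1, 0], by simp⟩

theorem U_eq : U = T * S := by
  decide

theorem neg_one_mem_center :
    (-1 : SpecialLinearGroup (Fin 2) ℤ) ∈ Subgroup.center (SpecialLinearGroup (Fin 2) ℤ) :=
  Subgroup.mem_center_iff.2 fun g => by simp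

/-- The generators of orders two and three of the modular group. -/
def projGen : Fin 2 → ProjectiveSpecialLinearGroup (Fin 2) ℤ :=
  ![QuotientGroup.mk' _ S, QuotientGroup.mk' _ U]

theorem projGen_pow (i : Fin 2) : projGen i ^ ((i : ℕ) + 2) = 1 := by
  have key : ∀ g : SpecialLinearGroup (Fin 2) ℤ, g = -1 →
      QuotientGroup.mk' (Subgroup.center (SpecialLinearGroup (Fin 2) ℤ)) g = 1 := by
    rintro g rfl
    exact (QuotientGroup.eq_one_iff _).2 neg_one_mem_center
  fin_cases i
  · change (QuotientGroup.mk' _ S) ^ 2 = 1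
    rw [← map_pow]
    apply key
    decide
  · change (QuotientGroup.mk' _ U) ^ 3 = 1
    rw [← map_pow]
    apply key
    decide

/-- The inclusions of the two cyclic free factors. -/
noncomputable def cyclicHom (i : Fin 2) :
    Multiplicative (ZMod ((i : ℕ) + 2)) →* ProjectiveSpecialLinearGroup (Fin 2) ℤ :=
  (zmodHomEquiv _ _).symm ⟨projGen i, projGen_pow i⟩

theorem cyclicHom_ofAdd_one (i : Fin 2) : cyclicHom i (Multiplicative.ofAdd 1) = projGen i :=
  zmodHomEquiv_symm_apply_ofAdd_one _ _ _

/-- `S` and `T` generate `SL₂(ℤ)`, and `T = U S⁻¹`. -/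
theorem lift_cyclicHom_surjective :
    Function.Surjective (Monoid.CoprodI.lift cyclicHom) := by
  rw [← MonoidHom.range_eq_top]
  have h0 : ∀ i, projGen i ∈ (Monoid.CoprodI.lift cyclicHom).range := fun i =>
    ⟨Monoid.CoprodI.of (Multiplicative.ofAdd 1), by
      rw [Monoid.CoprodI.lift_of, cyclicHom_ofAdd_one]⟩
  have hS : S ∈ (Monoid.CoprodI.lift cyclicHom).range.comap
      (QuotientGroup.mk' (Subgroup.center (SpecialLinearGroup (Fin 2) ℤ))) := h0 0
  have hU : U ∈ (Monoid.CoprodI.lift cyclicHom).range.comap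
      (QuotientGroup.mk' (Subgroup.center (SpecialLinearGroup (Fin 2) ℤ))) := h0 1
  have hT : T ∈ (Monoid.CoprodI.lift cyclicHom).range.comap
      (QuotientGroup.mk' (Subgroup.center (SpecialLinearGroup (Fin 2) ℤ))) := by
    rw [show T = U * S⁻¹ by rw [U_eq]; group]
    exact mul_mem hU (inv_mem hS)
  have htop : (Monoid.CoprodI.lift cyclicHom).range.comap
      (QuotientGroup.mk' (Subgroup.center (SpecialLinearGroup (Fin 2) ℤ))) = ⊤ := by
    rw [eq_top_iff, ← _root_.SpecialLinearGroup.SL2Z_generators, Subgroup.closure_le]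
    rintro x (rfl | rfl)
    exacts [hS, hT]
  rw [eq_top_iff]
  rintro x -
  obtain ⟨g, rfl⟩ := QuotientGroup.mk'_surjective _ x
  exact (htop ▸ Subgroup.mem_top g :)

/-- Ping-pong domains: matrices with positive diagonal and off-diagonal entries of fixed sign. -/
def pingPongSet (i : Fin 2) : Set (Matrix (Fin 2) (Fin 2) ℤ) :=
  {M | 0 < M 0 0 ∧ 0 < M 1 1 ∧ 0 < (![-1, 1] : Fin 2 → ℤ) i * M 0 1 ∧
    0 < (![-1, 1] : Fin 2 → ℤ) i * M 1 0}

theorem S_congruence (M : Matrix (Fin 2) (Fin 2) ℤ) :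
    S.1 * M * S.1ᵀ = !![M 1 1, -M 1 0; -M 0 1, M 0 0] := by
  have h : S.1ᵀ = !![0, 1; -1, 0] := by decide
  rw [Matrix.eta_fin_two M, h, S]
  simp

theorem U_congruence (M : Matrix (Fin 2) (Fin 2) ℤ) :
    U.1 * M * U.1ᵀ =
      !![M 0 0 - M 1 0 - (M 0 1 - M 1 1), M 0 0 - M 1 0; M 0 0 - M 0 1, M 0 0] := by
  have h : U.1ᵀ = !![1, 1; -1, 0] := by decide
  rw [Matrix.eta_fin_two M, h, U]
  simp only [Matrix.mul_fin_two]
  ext i j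
  fin_cases i <;> fin_cases j <;> simp <;> ring

/-- Ping-pong for the congruence action. `S` swaps the diagonal entries, and swaps and negates the
off-diagonal ones, so it carries positive off-diagonal entries to negative ones. When the
off-diagonal entries are negative, every entry produced by `U` or `U²` is a sum of positive terms.
-/
theorem lift_cyclicHom_injective :
    Function.Injective (Monoid.CoprodI.lift cyclicHom) := by
  have hcomp : projCongruenceHom.comp (Monoid.CoprodI.lift cyclicHom) =
      Monoid.CoprodI.lift fun i => projCongruenceHom.comp (cyclicHom i) := by
    apply Monoid.CoprodI.ext_hom
    intro i
    refine MonoidHom.ext fun x => ?_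
    simp
  suffices h : Function.Injective
      (Monoid.CoprodI.lift fun i => projCongruenceHom.comp (cyclicHom i)) by
    rw [← hcomp] at h
    exact Function.Injective.of_comp (f := projCongruenceHom) h
  have hS : ∀ M, projCongruenceHom (projGen 0) M = S.1 * M * S.1ᵀ := fun M => rfl
  have hU : ∀ M, projCongruenceHom (projGen 1) M = U.1 * M * U.1ᵀ := fun M => rfl
  -- With only two factors, ping-pong requires one of them to have at least three elements; the
  -- factor of order three serves.
  refine Monoid.CoprodI.lift_injective_of_ping_pong _ (Or.inr ⟨1, ?_⟩) pingPongSet ?_ ?_ ?_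
  · simp [Cardinal.mk_fintype]
  · intro i
    fin_cases i
    · exact ⟨!![1, -1; -1, 1], by simp [pingPongSet]⟩
    · exact ⟨!![1, 1; 1, 1], by simp [pingPongSet]⟩
  · have : Disjoint (pingPongSet 0) (pingPongSet 1) := by
      rw [Set.disjoint_left]
      rintro M ⟨-, -, h, -⟩ ⟨-, -, h', -⟩
      simp at h h'
      omega
    intro i j hij
    fin_cases i <;> fin_cases j
    · exact absurd rfl hij
    · exact this
    · exact this.symm
    · exact absurd rfl hij
  · intro i j hij h hh
    rintro _ ⟨M, hM, rfl⟩
    fin_cases i <;> fin_cases j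
    · exact absurd rfl hij
    · have h1 : h = Multiplicative.ofAdd 1 := by
        revert h; decide
      subst h1
      change projCongruenceHom (cyclicHom 0 (Multiplicative.ofAdd 1)) M ∈ _
      rw [cyclicHom_ofAdd_one, hS, S_congruence]
      simp [pingPongSet] at hM
      simp [pingPongSet]
      omega
    · have h1 : h = Multiplicative.ofAdd 1 ∨ h = Multiplicative.ofAdd 1 ^ 2 := by
        revert h; decide
      change projCongruenceHom (cyclicHom 1 h) M ∈ _
      rcases h1 with h1 | h1
      · rw [h1, cyclicHom_ofAdd_one, hU, U_congruence]
        simp [pingPongSet] at hM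
        simp [pingPongSet]
        omega
      · rw [h1, map_pow, map_pow, cyclicHom_ofAdd_one, sq,
          Equiv.Perm.mul_apply, hU, hU, U_congruence, U_congruence]
        simp [pingPongSet] at hM
        simp [pingPongSet]
        omega
    · exact absurd rfl hij

/-- The modular group is the free product of cyclic groups of orders two and three. -/
noncomputable def coprodEquiv :
    Monoid.CoprodI (fun i : Fin 2 => Multiplicative (ZMod ((i : ℕ) + 2))) ≃*
      ProjectiveSpecialLinearGroup (Fin 2) ℤ :=
  MulEquiv.ofBijective (Monoid.CoprodI.lift cyclicHom)
    ⟨lift_cyclicHom_injective, lift_cyclicHom_surjective⟩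

/-- Homomorphisms out of the modular group are pairs of elements with `a² = 1` and `b³ = 1`. -/
noncomputable def homEquiv (G : Type*) [Group G] :
    (ProjectiveSpecialLinearGroup (Fin 2) ℤ →* G) ≃ {a : G // a ^ 2 = 1} × {b : G // b ^ 3 = 1} :=
  (coprodEquiv.symm.monoidHomCongrLeftEquiv.trans Monoid.CoprodI.lift.symm).trans
    ((piFinTwoEquiv _).trans
      (Equiv.prodCongr (zmodHomEquiv 2 G) (zmodHomEquiv 3 G)))

end ModularGroup

/-! ### Permutation representations and subgroups of finite index. -/

/-- The number of homomorphisms from `Γ` to the symmetric group on `n` letters. -/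
noncomputable def permHomCount (Γ : Type*) [Group Γ] (n : ℕ) : ℕ :=
  Nat.card (Γ →* Equiv.Perm (Fin n))

/-- A permutation representation is transitive. -/
def IsTransitiveHom {Γ X : Type*} [Group Γ] (φ : Γ →* Equiv.Perm X) : Prop :=
  ∀ x y, ∃ g, φ g x = y

/-- The number of transitive homomorphisms from `Γ` to the symmetric group on `n` letters. -/
noncomputable def transitiveHomCount (Γ : Type*) [Group Γ] (n : ℕ) : ℕ :=
  Nat.card {φ : Γ →* Equiv.Perm (Fin n) // IsTransitiveHom φ}

section

variable {Γ : Type*} [Group Γ]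

theorem card_hom_perm_eq (X : Type*) [Fintype X] :
    Nat.card (Γ →* Equiv.Perm X) = permHomCount Γ (Fintype.card X) :=
  Nat.card_congr (Fintype.equivFin X).permCongrHom.monoidHomCongrRightEquiv

/-- The coset action of `Γ` on `Γ ⧸ H` transported along a labelling of the cosets. -/
def cosetHom {X : Type*} (H : Subgroup Γ) (e : Γ ⧸ H ≃ X) : Γ →* Equiv.Perm X :=
  e.permCongrHom.toMonoidHom.comp (MulAction.toPermHom Γ (Γ ⧸ H))

theorem cosetHom_apply {X : Type*} (H : Subgroup Γ) (e : Γ ⧸ H ≃ X) (g : Γ) (q : Γ ⧸ H) :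
    cosetHom H e g (e q) = e (g • q) := by
  simp [cosetHom, Equiv.permCongrHom]

theorem isTransitiveHom_cosetHom {X : Type*} (H : Subgroup Γ) (e : Γ ⧸ H ≃ X) :
    IsTransitiveHom (cosetHom H e) := by
  intro x y
  obtain ⟨p, rfl⟩ := e.surjective x
  obtain ⟨q, rfl⟩ := e.surjective y
  obtain ⟨g, rfl⟩ := MulAction.exists_smul_eq Γ p q
  exact ⟨g, cosetHom_apply H e g p⟩

/-- The subgroup is recovered as the stabilizer of the base point, which makes the correspondence
below injective. -/
theorem mem_iff_cosetHom {X : Type*} (H : Subgroup Γ) (e : Γ ⧸ H ≃ X) (g : Γ) :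
    g ∈ H ↔ cosetHom H e g (e (1 : Γ)) = e (1 : Γ) := by
  rw [cosetHom_apply, e.apply_eq_iff_eq, MulAction.Quotient.smul_coe, smul_eq_mul, mul_one,
    eq_comm, QuotientGroup.eq, inv_one, one_mul]

/-- A transitive representation with a base point is a subgroup with a labelling of its cosets. -/
theorem bijective_cosetHom (X : Type*) :
    Function.Bijective
      (fun p : Σ H : Subgroup Γ, (Γ ⧸ H ≃ X) =>
        ((⟨cosetHom p.1 p.2, isTransitiveHom_cosetHom p.1 p.2⟩, p.2 (1 : Γ)) :
          {φ : Γ →* Equiv.Perm X // IsTransitiveHom φ} × X)) := by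
  constructor
  · rintro ⟨H, e⟩ ⟨K, f⟩ h
    simp only [Prod.mk.injEq, Subtype.mk.injEq] at h
    obtain ⟨h1, h2⟩ := h
    obtain rfl : H = K := by
      ext g
      rw [mem_iff_cosetHom H e, mem_iff_cosetHom K f, h1, h2]
    congr 1
    ext q
    induction q using QuotientGroup.induction_on with
    | H g =>
      have := cosetHom_apply H e g (1 : Γ)
      have := cosetHom_apply H f g (1 : Γ)
      simp_all
  · rintro ⟨⟨φ, hφ⟩, x⟩
    let _ : MulAction Γ X := MulAction.compHom X φ
    have hsmul : ∀ (g : Γ) (y : X), g • y = φ g y := fun _ _ => rfl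
    have : MulAction.IsPretransitive Γ X := ⟨hφ⟩
    let e : Γ ⧸ MulAction.stabilizer Γ x ≃ X :=
      Equiv.ofBijective (MulAction.ofQuotientStabilizer Γ x)
        ⟨MulAction.injective_ofQuotientStabilizer Γ x, fun y => by
          obtain ⟨g, hg⟩ := MulAction.exists_smul_eq Γ x y
          exact ⟨(g : Γ), hg⟩⟩
    have he : ∀ g : Γ, e (g : Γ ⧸ MulAction.stabilizer Γ x) = g • x :=
      fun g => rfl
    refine ⟨⟨MulAction.stabilizer Γ x, e⟩, ?_⟩
    simp only [Prod.mk.injEq, Subtype.mk.injEq]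
    constructor
    · ext g y
      obtain ⟨q, rfl⟩ := e.surjective y
      rw [cosetHom_apply]
      induction q using QuotientGroup.induction_on with
      | H k => rw [MulAction.Quotient.smul_coe, he, he, smul_eq_mul, mul_smul, hsmul]
    · rw [he, one_smul]

/-- Labelling the cosets of a subgroup of index `n ≠ 0` amounts to choosing a permutation. -/
noncomputable def sigmaIndexEquiv (Γ : Type*) [Group Γ] {n : ℕ} (hn : n ≠ 0) :
    (Σ H : Subgroup Γ, (Γ ⧸ H ≃ Fin n)) ≃
      {H : Subgroup Γ // H.index = n} × Equiv.Perm (Fin n) :=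
  have e (H : {H : Subgroup Γ // H.index = n}) : Γ ⧸ H.1 ≃ Fin n :=
    -- An infinite index is recorded as 0, so `n ≠ 0` is what forces the quotient to be finite.
    have : Finite (Γ ⧸ H.1) := Nat.finite_of_card_ne_zero (by
      have := H.2
      rw [Subgroup.index] at this
      rwa [this])
    Finite.equivFinOfCardEq H.2
  have hi (p : Σ H : Subgroup Γ, (Γ ⧸ H ≃ Fin n)) : p.1.index = n := by
    rw [Subgroup.index, Nat.card_congr p.2, Nat.card_fin]
  { toFun := fun p => (⟨p.1, hi p⟩, (e ⟨p.1, hi p⟩).symm.trans p.2)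
    invFun := fun q => ⟨q.1.1, (e q.1).trans q.2⟩
    left_inv := fun p => by
      ext
      · rfl
      · exact heq_of_eq (Equiv.ext fun _ => by simp)
    right_inv := fun q => by
      ext <;> simp }

theorem mul_transitiveHomCount (Γ : Type*) [Group Γ] {n : ℕ} (hn : n ≠ 0) :
    n * transitiveHomCount Γ n = n.factorial * Nat.card {H : Subgroup Γ // H.index = n} := by
  have h := Nat.card_congr ((sigmaIndexEquiv Γ hn).symm.trans
    (Equiv.ofBijective _ (bijective_cosetHom (Γ := Γ) (Fin n))))
  rw [Nat.card_prod, Nat.card_prod, Nat.card_perm, Nat.card_fin] at h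
  rw [transitiveHomCount, mul_comm, ← h, mul_comm]

theorem finite_subgroup_index (Γ : Type*) [Group Γ] {n : ℕ} (hn : n ≠ 0)
    [Finite (Γ →* Equiv.Perm (Fin n))] : Finite {H : Subgroup Γ // H.index = n} := by
  have := Finite.of_equiv _ ((sigmaIndexEquiv Γ hn).symm.trans
    (Equiv.ofBijective _ (bijective_cosetHom (Γ := Γ) (Fin n)))).symm
  exact Finite.of_surjective _ (Prod.fst_surjective
    (α := {H : Subgroup Γ // H.index = n}) (β := Equiv.Perm (Fin n)))

/-- Restriction of a permutation representation to an invariant subset. -/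
def restrictHom {X : Type*} (φ : Γ →* Equiv.Perm X) (p : X → Prop)
    (hp : ∀ g x, p (φ g x) ↔ p x) : Γ →* Equiv.Perm {x // p x} where
  toFun g := (φ g).subtypePerm (hp g)
  map_one' := by ext; simp
  map_mul' g h := by
    ext
    rw [Equiv.Perm.mul_apply]
    simp only [Equiv.Perm.subtypePerm_apply, map_mul, Equiv.Perm.mul_apply]

/-- Gluing of permutation representations on a subset and its complement. -/
def glueHom {X : Type*} (p : X → Prop) [DecidablePred p]
    (q : (Γ →* Equiv.Perm {x // p x}) × (Γ →* Equiv.Perm {x // ¬ p x})) : Γ →* Equiv.Perm X :=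
  (Equiv.Perm.subtypeCongrHom p).comp (q.1.prod q.2)

/-- The orbit of a point that does not reach everything is a proper nonempty invariant subset. -/
theorem exists_glueHom_eq {n : ℕ} (φ : Γ →* Equiv.Perm (Fin n)) (hφ : ¬ IsTransitiveHom φ) :
    ∃ A : Finset (Fin n), (0 < #A ∧ #A < n) ∧
      ∃ q, glueHom (Γ := Γ) (fun x => x ∈ A) q = φ := by
  classical
  simp only [IsTransitiveHom, not_forall] at hφ
  obtain ⟨x, y, hxy⟩ := hφ
  let A : Finset (Fin n) := univ.filter fun z => ∃ g, φ g x = z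
  have hx : x ∈ A := by simpa [A] using ⟨1, by simp⟩
  have hy : y ∉ A := by simpa [A] using hxy
  have hA : ∀ g z, φ g z ∈ A ↔ z ∈ A := by
    intro g z
    simp only [A, mem_filter, mem_univ, true_and]
    constructor
    · rintro ⟨k, hk⟩
      exact ⟨g⁻¹ * k, by simp [hk]⟩
    · rintro ⟨k, rfl⟩
      exact ⟨g * k, by simp⟩
  refine ⟨A, ⟨card_pos.2 ⟨x, hx⟩, ?_⟩,
    (restrictHom φ _ hA, restrictHom φ _ fun g z => not_congr (hA g z)), ?_⟩
  · simpa using card_lt_univ_of_notMem hy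
  · ext g z
    by_cases hz : z ∈ A
    · simp [glueHom, restrictHom, Equiv.Perm.subtypeCongr.left_apply, hz]
    · simp [glueHom, restrictHom, Equiv.Perm.subtypeCongr.right_apply, hz]

/-- Each intransitive representation is recovered by gluing from a chosen invariant subset of size
`k` and its two restrictions. The subset is not unique, so this gives only an upper bound, which is
all that is needed. -/
theorem permHomCount_le_add [∀ n, Finite (Γ →* Equiv.Perm (Fin n))] (n : ℕ) :
    permHomCount Γ n ≤ transitiveHomCount Γ n +
      ∑ k ∈ Ioo 0 n, n.choose k * (permHomCount Γ k * permHomCount Γ (n - k)) := by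
  classical
  have hfin (X : Type) [Fintype X] : Finite (Γ →* Equiv.Perm X) :=
    Finite.of_equiv _ (Fintype.equivFin X).permCongrHom.monoidHomCongrRightEquiv.symm
  have hsplit : permHomCount Γ n = transitiveHomCount Γ n +
      Nat.card {φ : Γ →* Equiv.Perm (Fin n) // ¬ IsTransitiveHom φ} := by
    rw [permHomCount, transitiveHomCount, ← Nat.card_sum]
    exact Nat.card_congr (Equiv.sumCompl _).symm
  rw [hsplit]
  gcongr
  let T := Σ A : {A : Finset (Fin n) // 0 < #A ∧ #A < n},
    (Γ →* Equiv.Perm {x // x ∈ A.1}) × (Γ →* Equiv.Perm {x // ¬ x ∈ A.1})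
  have hex : ∀ φ : {φ : Γ →* Equiv.Perm (Fin n) // ¬ IsTransitiveHom φ},
      ∃ t : T, glueHom (Γ := Γ) (fun x => x ∈ t.1.1) t.2 = φ.1 := fun φ => by
    obtain ⟨A, hA, q, hq⟩ := exists_glueHom_eq φ.1 φ.2
    exact ⟨⟨⟨A, hA⟩, q⟩, hq⟩
  choose F hF using hex
  have hinj : Function.Injective F := fun a b hab => by
    apply Subtype.ext
    rw [← hF a, ← hF b, hab]
  calc Nat.card {φ : Γ →* Equiv.Perm (Fin n) // ¬ IsTransitiveHom φ}
      ≤ Nat.card T := Nat.card_le_card_of_injective F hinj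
    _ = ∑ A : {A : Finset (Fin n) // 0 < #A ∧ #A < n},
          permHomCount Γ #A.1 * permHomCount Γ (n - #A.1) := by
        rw [Nat.card_sigma]
        refine sum_congr rfl fun A _ => ?_
        rw [Nat.card_prod, card_hom_perm_eq, card_hom_perm_eq, Fintype.card_subtype_compl]
        simp
    _ = ∑ A ∈ (univ : Finset (Fin n)).powerset, if 0 < #A ∧ #A < n then
          permHomCount Γ #A * permHomCount Γ (n - #A) else 0 := by
        rw [← sum_filter, sum_subtype (p := fun A : Finset (Fin n) => 0 < #A ∧ #A < n)]
        simp
    _ = ∑ k ∈ range (n + 1), n.choose k * if 0 < k ∧ k < n then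
          permHomCount Γ k * permHomCount Γ (n - k) else 0 := by
        rw [sum_powerset_apply_card (fun k => if 0 < k ∧ k < n then
          permHomCount Γ k * permHomCount Γ (n - k) else 0)]
        simp
    _ = _ := by
        simp_rw [mul_ite, mul_zero]
        rw [← sum_filter]
        congr 1
        ext k
        simp
        omega

theorem transitiveHomCount_le {n : ℕ} [Finite (Γ →* Equiv.Perm (Fin n))] :
    transitiveHomCount Γ n ≤ permHomCount Γ n :=
  Nat.card_le_card_of_injective _ Subtype.val_injective

end

/-! ### Permutations with `σ ^ p = 1`, sorted by cycle type. -/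

/-- The number of permutations of `n` letters whose order divides `p`. -/
noncomputable def powOneCount (p n : ℕ) : ℕ :=
  Nat.card {σ : Equiv.Perm (Fin n) // σ ^ p = 1}

theorem card_cycleType_replicate (p n j : ℕ) (hp : 2 ≤ p) :
    (#({σ | σ.cycleType = Multiset.replicate j p} : Finset (Equiv.Perm (Fin n))) : ℝ) =
      if p * j ≤ n then (n.factorial : ℝ) / ((n - p * j).factorial * p ^ j * j.factorial)
        else 0 := by
  have h := Equiv.Perm.card_of_cycleType_mul_eq (Fin n) (Multiset.replicate j p)
  have h1 : (∏ x ∈ (Multiset.replicate j p).toFinset, ((Multiset.replicate j p).count x).factorial)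
      = j.factorial := by
    rcases eq_or_ne j 0 with rfl | hj
    · simp
    · rw [Multiset.toFinset_replicate, if_neg hj]
      simp
  have h2 : ∀ a ∈ Multiset.replicate j p, 2 ≤ a := fun a ha => by
    rwa [Multiset.eq_of_mem_replicate ha]
  rw [h1] at h
  simp only [Multiset.sum_replicate, Multiset.prod_replicate, Fintype.card_fin, smul_eq_mul,
    mul_comm j p, and_iff_left h2] at h
  have hp0 : (p : ℝ) ≠ 0 := by positivity
  split_ifs at h ⊢ with hle
  · rw [eq_div_iff (by positivity)]
    exact_mod_cast h
  · have : (n - p * j).factorial * p ^ j * j.factorial ≠ 0 := by positivity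
    exact_mod_cast (mul_eq_zero.1 h).resolve_right this

/-- For prime `p`, `σ ^ p = 1` means that every nontrivial cycle has length `p`, so the cycle type
is determined by the number `j` of such cycles. -/
theorem powOneCount_eq_sum (p n : ℕ) [hp : Fact p.Prime] :
    (powOneCount p n : ℝ) = ∑ j ∈ range (n + 1), if p * j ≤ n then
      (n.factorial : ℝ) / ((n - p * j).factorial * p ^ j * j.factorial) else 0 := by
  classical
  have hset : (univ.filter fun σ : Equiv.Perm (Fin n) => σ ^ p = 1) =
      (range (n + 1)).biUnion fun j =>
        univ.filter fun σ : Equiv.Perm (Fin n) => σ.cycleType = Multiset.replicate j p := by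
    ext σ
    simp only [mem_filter, mem_univ, true_and, mem_biUnion, mem_range,
      Equiv.Perm.pow_prime_eq_one_iff, ← Multiset.eq_replicate_card]
    constructor
    · intro h
      refine ⟨_, ?_, h⟩
      have h1 := σ.sum_cycleType_le
      rw [h, Multiset.sum_replicate, Fintype.card_fin, smul_eq_mul] at h1
      nlinarith [hp.out.two_le]
    · rintro ⟨j, -, h⟩
      rw [h, Multiset.card_replicate]
  rw [powOneCount, Nat.card_eq_fintype_card, Fintype.card_subtype, hset, card_biUnion]
  · push_cast
    exact sum_congr rfl fun j _ => card_cycleType_replicate p n j hp.out.two_le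
  · intro i _ j _ hij
    change Disjoint _ _
    rw [Finset.disjoint_left]
    intro σ h h'
    simp only [mem_filter, mem_univ, true_and] at h h'
    apply hij
    simpa using congrArg Multiset.card (h.symm.trans h')

/-- The normalised count as a sum over the number `k` of fixed points. -/
theorem powOneCount_div_factorial (p n : ℕ) [hp : Fact p.Prime] :
    (powOneCount p n : ℝ) / n.factorial = ∑ k ∈ range (n + 1), if p ∣ n - k then
      1 / ((k.factorial : ℝ) * (p ^ ((n - k) / p) * ((n - k) / p).factorial)) else 0 := by
  have hp0 := hp.out.pos
  rw [powOneCount_eq_sum, sum_div, ← sum_filter]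
  simp only [ite_div, zero_div]
  rw [← sum_filter]
  refine sum_nbij' (fun j => n - p * j) (fun k => (n - k) / p) ?_ ?_ ?_ ?_ ?_
  · intro j hj
    simp only [mem_filter, mem_range] at hj ⊢
    refine ⟨by omega, ?_⟩
    rw [Nat.sub_sub_self hj.2]
    exact dvd_mul_right _ _
  · intro k hk
    simp only [mem_filter, mem_range] at hk ⊢
    have := Nat.div_le_self (n - k) p
    have := Nat.mul_div_le (n - k) p
    omega
  · intro j hj
    simp only [mem_filter, mem_range] at hj ⊢
    rw [Nat.sub_sub_self hj.2, Nat.mul_div_cancel_left _ hp0]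
  · intro k hk
    simp only [mem_filter, mem_range] at hk ⊢
    rw [Nat.mul_div_cancel' hk.2]
    omega
  · intro j hj
    simp only [mem_filter, mem_range] at hj ⊢
    rw [Nat.sub_sub_self hj.2, Nat.mul_div_cancel_left _ hp0]
    have : (n.factorial : ℝ) ≠ 0 := by positivity
    field_simp

/-! ### Poisson averages over residue classes. -/

/-- The Poisson distribution of parameter `l`. -/
noncomputable def poissonWeight (l : ℝ) (k : ℕ) : ℝ := Real.exp (-l) * l ^ k / k.factorial

theorem poissonWeight_nonneg {l : ℝ} (hl : 0 ≤ l) (k : ℕ) : 0 ≤ poissonWeight l k := by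
  unfold poissonWeight; positivity

theorem hasSum_poissonWeight (l : ℝ) : HasSum (poissonWeight l) 1 := by
  have h := (NormedSpace.expSeries_div_hasSum_exp (𝔸 := ℝ) l).mul_left (Real.exp (-l))
  rw [← Real.exp_eq_exp_ℝ, ← Real.exp_add, neg_add_cancel, Real.exp_zero] at h
  refine h.congr_fun fun k => ?_
  rw [poissonWeight, mul_div_assoc]

/-- The Stein–Chen identity for the Poisson distribution. -/
theorem hasSum_mul_natCast_mul_poissonWeight {l s : ℝ} {f : ℕ → ℝ}
    (h : HasSum (fun k => f (k + 1) * poissonWeight l k) s) :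
    HasSum (fun k : ℕ => f k * k * poissonWeight l k) (l * s) := by
  rw [← hasSum_nat_add_iff' 1]
  simp only [range_one, sum_singleton, Nat.cast_zero, mul_zero, zero_mul, sub_zero]
  refine (h.mul_left l).congr_fun fun k => ?_
  simp only [poissonWeight, Nat.factorial_succ, pow_succ]
  push_cast
  field_simp

theorem hasSum_sub_sq_mul_poissonWeight (l : ℝ) :
    HasSum (fun k : ℕ => ((k : ℝ) - l) ^ 2 * poissonWeight l k) l := by
  have h0 := hasSum_poissonWeight l
  have h1 := hasSum_mul_natCast_mul_poissonWeight (f := fun _ => 1) (by simpa using h0)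
  have h2 := hasSum_mul_natCast_mul_poissonWeight (l := l) (f := fun k => k)
    (s := l * 1 + 1) ((h1.add h0).congr_fun fun k => by push_cast; ring)
  have h3 := (h2.sub (h1.mul_left (2 * l))).add (h0.mul_left (l ^ 2))
  rw [show l * (l * 1 + 1) - 2 * l * (l * 1) + l ^ 2 * 1 = l by ring] at h3
  exact h3.congr_fun fun k => by ring

theorem summable_mul_poissonWeight {l : ℝ} (hl : 0 ≤ l) {f : ℕ → ℝ} {A B : ℝ}
    (hf : ∀ k, |f k| ≤ A + B * ((k : ℝ) - l) ^ 2) : Summable fun k => f k * poissonWeight l k := by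
  have h := ((hasSum_poissonWeight l).mul_left A).add
    ((hasSum_sub_sq_mul_poissonWeight l).mul_left B)
  refine Summable.of_norm_bounded h.summable fun k => ?_
  rw [Real.norm_eq_abs, abs_mul, abs_of_nonneg (poissonWeight_nonneg hl k), ← mul_assoc, ← add_mul]
  exact mul_le_mul_of_nonneg_right (hf k) (poissonWeight_nonneg hl k)

/-- The variance is `l`, so a quadratic bound on `f` can be integrated exactly. Both
equidistribution and concentration are obtained from this estimate. -/
theorem abs_tsum_mul_poissonWeight_le {l : ℝ} (hl : 0 ≤ l) {f : ℕ → ℝ} {A B : ℝ}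
    (hf : ∀ k, |f k| ≤ A + B * ((k : ℝ) - l) ^ 2) :
    |∑' k, f k * poissonWeight l k| ≤ A + B * l := by
  have h := ((hasSum_poissonWeight l).mul_left A).add
    ((hasSum_sub_sq_mul_poissonWeight l).mul_left B)
  rw [mul_one] at h
  rw [← Real.norm_eq_abs]
  refine tsum_of_norm_bounded h fun k => ?_
  rw [Real.norm_eq_abs, abs_mul, abs_of_nonneg (poissonWeight_nonneg hl k), ← mul_assoc, ← add_mul]
  exact mul_le_mul_of_nonneg_right (hf k) (poissonWeight_nonneg hl k)

/-- The indicator of a residue class. -/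
def residueIndicator (p r k : ℕ) : ℝ := if k ≡ r [MOD p] then 1 else 0

theorem abs_residueIndicator_le (p r k : ℕ) : |residueIndicator p r k| ≤ 1 := by
  unfold residueIndicator; split_ifs <;> simp

/-- The probability that a Poisson variable is congruent to `r` modulo `p`. -/
noncomputable def poissonResidue (l : ℝ) (p r : ℕ) : ℝ :=
  ∑' k, residueIndicator p r k * poissonWeight l k

theorem hasSum_poissonResidue {l : ℝ} (hl : 0 ≤ l) (p r : ℕ) :
    HasSum (fun k => residueIndicator p r k * poissonWeight l k) (poissonResidue l p r) :=
  (summable_mul_poissonWeight hl (A := 1) (B := 0) fun k => by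
    simpa using abs_residueIndicator_le p r k).hasSum

/-- By Stein–Chen for the indicator `f` of the class `r + 1`, the difference is the mean of `f(k) (1
- k/l)`. The bound `x ≤ (1 + l x²)/√l` for `x = |1 - k/l|` reduces this to the variance, and each of
the two terms contributes `1/√l`. -/
theorem abs_poissonResidue_succ_sub_le {l : ℝ} (hl : 0 < l) (p r : ℕ) :
    |poissonResidue l p (r + 1) - poissonResidue l p r| ≤ 2 / √l := by
  have h1 := hasSum_mul_natCast_mul_poissonWeight (l := l) (f := residueIndicator p (r + 1))
    ((hasSum_poissonResidue hl.le p r).congr_fun fun k => by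
      simp only [residueIndicator, Nat.ModEq.add_iff_right (Nat.ModEq.refl 1)])
  have h2 := (hasSum_poissonResidue hl.le p (r + 1)).sub (h1.mul_left l⁻¹)
  rw [inv_mul_cancel_left₀ hl.ne'] at h2
  have hs : 0 < √l := Real.sqrt_pos.2 hl
  have hss : √l * √l = l := Real.mul_self_sqrt hl.le
  have h3 := abs_tsum_mul_poissonWeight_le hl.le
    (f := fun k => residueIndicator p (r + 1) k * (1 - k / l)) (A := 1 / √l)
    (B := 1 / (√l * l)) (fun k => by
      rw [abs_mul]
      refine (mul_le_of_le_one_left (abs_nonneg _) (abs_residueIndicator_le _ _ _)).trans ?_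
      have e : ((k : ℝ) - l) ^ 2 = l ^ 2 * |1 - k / l| ^ 2 := by
        rw [sq_abs]; field_simp; ring
      set x := |1 - (k : ℝ) / l| with hx
      have hx0 : 0 ≤ x := abs_nonneg _
      have e2 : 1 / √l + 1 / (√l * l) * (l ^ 2 * x ^ 2) = (1 + l * x ^ 2) / √l := by
        field_simp
      rw [e, e2, le_div_iff₀ hs]
      nlinarith [sq_nonneg (√l * x - 1)])
  have h4 : (1 : ℝ) / √l + 1 / (√l * l) * l = 2 / √l := by field_simp; norm_num
  rw [h4] at h3
  convert h3 using 2
  rw [← h2.tsum_eq]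
  exact tsum_congr fun k => by field_simp

theorem sum_poissonResidue {l : ℝ} (hl : 0 ≤ l) {p : ℕ} (hp : 0 < p) :
    ∑ r ∈ range p, poissonResidue l p r = 1 := by
  have h := hasSum_sum (s := range p) fun r _ => hasSum_poissonResidue hl p r
  refine h.unique ((hasSum_poissonWeight l).congr_fun fun k => ?_)
  rw [← sum_mul, sum_eq_single (k % p)]
  · rw [residueIndicator, if_pos (Nat.mod_modEq k p).symm, one_mul]
  · intro r hr hrk
    rw [residueIndicator, if_neg]
    intro hk
    exact hrk ((Nat.mod_eq_of_lt (mem_range.1 hr)).symm.trans hk.symm)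
  · intro hk
    exact absurd (mem_range.2 (Nat.mod_lt _ hp)) hk

theorem poissonResidue_mod (l : ℝ) (p r : ℕ) :
    poissonResidue l p (r % p) = poissonResidue l p r := by
  have h (k : ℕ) : residueIndicator p (r % p) k = residueIndicator p r k :=
    if_congr (by simp [Nat.ModEq]) rfl rfl
  simp only [poissonResidue, h]

/-- Neighbouring classes are close in probability, so all `p` of them are close to class 0; since
they sum to 1, each is close to `1/p`. -/
theorem abs_poissonResidue_sub_le {l : ℝ} (hl : 0 < l) {p : ℕ} (hp : 0 < p) (r : ℕ) :
    |poissonResidue l p r - 1 / p| ≤ 4 * p / √l := by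
  have hs : 0 < √l := Real.sqrt_pos.2 hl
  have key (r : ℕ) : |poissonResidue l p r - poissonResidue l p 0| ≤ r * (2 / √l) := by
    induction r with
    | zero => simp
    | succ r ih =>
      have := abs_sub_le (poissonResidue l p (r + 1)) (poissonResidue l p r) (poissonResidue l p 0)
      have := abs_poissonResidue_succ_sub_le hl p r
      push_cast
      linarith
  have key' (r : ℕ) (hr : r < p) :
      |poissonResidue l p r - poissonResidue l p 0| ≤ p * (2 / √l) :=
    (key r).trans (by gcongr)
  have h0 : |poissonResidue l p 0 - 1 / p| ≤ p * (2 / √l) := by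
    have hp' : (0 : ℝ) < p := by exact_mod_cast hp
    have e : poissonResidue l p 0 - 1 / p =
        -(∑ r ∈ range p, (poissonResidue l p r - poissonResidue l p 0)) / p := by
      rw [sum_sub_distrib, sum_poissonResidue hl.le hp]
      simp
      field_simp
    rw [e, abs_div, abs_neg, abs_of_pos hp', div_le_iff₀ hp']
    refine (abs_sum_le_sum_abs _ _).trans ?_
    refine (sum_le_sum fun r hr => key' r (mem_range.1 hr)).trans ?_
    simp
    exact le_of_eq (by ring)
  rw [← poissonResidue_mod]
  have := key' (r % p) (Nat.mod_lt _ hp)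
  have h5 := abs_sub_le (poissonResidue l p (r % p)) (poissonResidue l p 0) (1 / p)
  calc _ ≤ _ := h5
    _ ≤ p * (2 / √l) + p * (2 / √l) := add_le_add this h0
    _ = _ := by ring

/-- Averages over a residue class against a Poisson distribution of growing parameter. -/
theorem tendsto_tsum_residueIndicator_mul_poissonWeight {lam : ℕ → ℝ}
    (hlam : Tendsto lam atTop atTop) {p : ℕ} (hp : 0 < p) (r : ℕ → ℕ) (G : ℕ → ℕ → ℝ) (c : ℝ)
    (hG : ∀ ε > 0, ∃ M, 0 ≤ M ∧ ∀ᶠ n in atTop, ∀ k, k ≡ r n [MOD p] →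
      |G n k - c| ≤ ε + M * (((k : ℝ) - lam n) ^ 2 / lam n ^ 2)) :
    Tendsto (fun n => ∑' k, residueIndicator p (r n) k * G n k * poissonWeight (lam n) k) atTop
      (𝓝 (c / p)) := by
  have hlow : Tendsto (fun n => c * poissonResidue (lam n) p (r n)) atTop (𝓝 (c * (1 / p))) := by
    refine Tendsto.const_mul c ?_
    rw [tendsto_iff_norm_sub_tendsto_zero]
    have hz : Tendsto (fun n => 4 * (p : ℝ) / √(lam n)) atTop (𝓝 0) :=
      (Real.tendsto_sqrt_atTop.comp hlam).const_div_atTop _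
    refine squeeze_zero' (Eventually.of_forall fun n => norm_nonneg _) ?_ hz
    filter_upwards [hlam.eventually_gt_atTop 0] with n hn
    exact abs_poissonResidue_sub_le hn hp (r n)
  rw [mul_one_div] at hlow
  have hbound {ε M : ℝ} (hε : 0 < ε) (hM0 : 0 ≤ M) {n : ℕ} (hM : ∀ k, k ≡ r n [MOD p] →
      |G n k - c| ≤ ε + M * (((k : ℝ) - lam n) ^ 2 / lam n ^ 2)) (k : ℕ) :
      |residueIndicator p (r n) k * (G n k - c)| ≤ ε + M / lam n ^ 2 * ((k : ℝ) - lam n) ^ 2 := by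
    unfold residueIndicator
    split_ifs with hk
    · rw [one_mul]
      exact (hM k hk).trans (le_of_eq (by ring))
    · rw [zero_mul, abs_zero]
      positivity
  suffices h : Tendsto (fun n => ∑' k, residueIndicator p (r n) k * (G n k - c) *
      poissonWeight (lam n) k) atTop (𝓝 0) by
    have h' := h.add hlow
    rw [zero_add] at h'
    refine h'.congr' ?_
    obtain ⟨M, hM0, hM⟩ := hG 1 one_pos
    filter_upwards [hlam.eventually_gt_atTop 0, hM] with n hn hM
    have hs := summable_mul_poissonWeight hn.le (hbound one_pos hM0 hM)
    rw [← (hs.hasSum.add ((hasSum_poissonResidue hn.le p (r n)).mul_left c)).tsum_eq]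
    exact tsum_congr fun k => by ring
  rw [Metric.tendsto_nhds]
  intro ε hε
  obtain ⟨M, hM0, hM⟩ := hG (ε / 2) (half_pos hε)
  filter_upwards [hlam.eventually_gt_atTop 0, hlam.eventually_gt_atTop (2 * M / ε), hM]
    with n hn hn' hM
  rw [Real.dist_eq, sub_zero]
  -- Chebyshev's argument: a variance of `lam n` against the denominator `lam n ^ 2` leaves an error
  -- `M / lam n`.
  refine (abs_tsum_mul_poissonWeight_le hn.le (hbound (half_pos hε) hM0 hM)).trans_lt ?_
  have e : M / lam n ^ 2 * lam n = M / lam n := by field_simp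
  have : M / lam n < ε / 2 := by
    rw [div_lt_iff₀ hε] at hn'
    rw [div_lt_iff₀ hn]
    linarith
  rw [e]
  linarith

/-! ### Stirling's formula and the asymptotics of the number of solutions. -/

/-- The ratio of `1 / (p ^ j * j!)`, where `n = k + p * j`, to its main term. -/
noncomputable def stirlingRatio (p n k : ℕ) : ℝ :=
  √(2 * Real.pi * n / p) *
    ((((n - k) / p : ℕ) / Real.exp 1 : ℝ) ^ ((n - k) / p) / (((n - k) / p).factorial : ℝ)) *
    Real.exp (((n - k : ℝ) * (Real.log n - Real.log (n - k)) - k) / p)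

theorem stirlingRatio_nonneg (p n k : ℕ) : 0 ≤ stirlingRatio p n k := by
  unfold stirlingRatio; positivity

/-- The main term in the asymptotics of the number of solutions of `σ ^ p = 1`. -/
noncomputable def stirlingScale (p n : ℕ) : ℝ :=
  Real.exp (-((n : ℝ) / p * (Real.log n - 1))) / √(2 * Real.pi * n / p)

/-- This is exact: `stirlingRatio` absorbs the error of Stirling's formula. The parameter `n^(1/p)`
is chosen so that its `k`-th power `n^(k/p)` cancels the dependence on `k` of the main exponential.
-/
theorem inv_eq_stirlingScale_mul {p n k : ℕ} (hp : 0 < p) (hn : 0 < n) (hk : k ≤ n)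
    (hpk : p ∣ n - k) :
    1 / ((k.factorial : ℝ) * (p ^ ((n - k) / p) * ((n - k) / p).factorial)) =
      stirlingScale p n * Real.exp ((n : ℝ) ^ (1 / p : ℝ)) *
        (stirlingRatio p n k * poissonWeight ((n : ℝ) ^ (1 / p : ℝ)) k) := by
  obtain ⟨j, hj⟩ := hpk
  have hn' : (0 : ℝ) < n := by exact_mod_cast hn
  have hp' : (0 : ℝ) < p := by exact_mod_cast hp
  have hnk : (n : ℝ) - k = p * j := by
    rw [← Nat.cast_sub hk, hj]; push_cast; ring
  have hjp : (j / Real.exp 1 : ℝ) ^ j * p ^ j =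
      Real.exp (j * (Real.log (p * j) - 1)) := by
    rcases Nat.eq_zero_or_pos j with rfl | hj0
    · simp
    · have hj0' : (0 : ℝ) < j := by exact_mod_cast hj0
      rw [← mul_pow, Real.exp_nat_mul, Real.exp_sub, Real.exp_log (by positivity)]
      congr 1; ring
  have hlam : ((n : ℝ) ^ (1 / p : ℝ)) ^ k = Real.exp (k / p * Real.log n) := by
    rw [← Real.rpow_mul_natCast hn'.le, Real.rpow_def_of_pos hn']
    congr 1; ring
  have hdiv : (n - k) / p = j := by rw [hj, Nat.mul_div_cancel_left _ hp]
  unfold stirlingScale stirlingRatio poissonWeight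
  rw [hdiv, hnk, hlam, Real.exp_neg ((n : ℝ) ^ (1 / p : ℝ))]
  have hs : (0 : ℝ) < √(2 * Real.pi * n / p) := by positivity
  have e1 : Real.exp (-((n : ℝ) / p * (Real.log n - 1))) *
      Real.exp ((p * j * (Real.log n - Real.log (p * j)) - k) / p) *
      Real.exp (k / p * Real.log n) * Real.exp (j * (Real.log (p * j) - 1)) = 1 := by
    rw [← Real.exp_add, ← Real.exp_add, ← Real.exp_add, Real.exp_eq_one_iff]
    have : (k : ℝ) = n - p * j := by linarith
    rw [this]
    field_simp
    ring
  rw [← hjp] at e1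
  have hE := (Real.exp_pos ((n : ℝ) ^ (1 / p : ℝ))).ne'
  have hkf : (k.factorial : ℝ) ≠ 0 := by positivity
  have hjf : (j.factorial : ℝ) ≠ 0 := by positivity
  have hpj : (p : ℝ) ^ j ≠ 0 := by positivity
  generalize Real.exp ((n : ℝ) ^ (1 / p : ℝ)) = A at *
  generalize (j / Real.exp 1 : ℝ) ^ j = B at *
  generalize Real.exp (-((n : ℝ) / p * (Real.log n - 1))) = C at *
  generalize Real.exp ((p * j * (Real.log n - Real.log (p * j)) - k) / p) = D at *
  generalize Real.exp (k / p * Real.log n) = E at *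
  generalize √(2 * Real.pi * n / p) = S at *
  generalize (p : ℝ) ^ j = P at *
  field_simp
  linear_combination -e1

theorem abs_one_sub_mul_log_one_sub_le {x : ℝ} (hx : |x| ≤ 1 / 2) :
    |(-(1 - x) * Real.log (1 - x) - x) + x ^ 2 / 2| ≤ 4 * |x| ^ 3 := by
  have h := Real.abs_log_sub_add_sum_range_le (x := x) (by linarith) 2
  simp only [sum_range_succ, range_zero, sum_empty] at h
  norm_num at h
  have h2 : |x + x ^ 2 / 2 + Real.log (1 - x)| ≤ 2 * |x| ^ 3 := by
    refine h.trans ?_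
    rw [div_le_iff₀ (by linarith)]
    have : 0 ≤ |x| ^ 3 := by positivity
    nlinarith
  have e : (-(1 - x) * Real.log (1 - x) - x) + x ^ 2 / 2 =
      -(1 - x) * (x + x ^ 2 / 2 + Real.log (1 - x)) - x ^ 3 / 2 := by ring
  have h3 : |(-(1 - x))| ≤ 3 / 2 := by
    rw [abs_neg]
    exact (abs_sub _ _).trans (by rw [abs_one]; linarith)
  rw [e]
  refine (abs_sub _ _).trans ?_
  rw [abs_mul, abs_div, abs_pow, abs_two]
  have := mul_le_mul h3 h2 (abs_nonneg _) (by norm_num)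
  have : 0 ≤ |x| ^ 3 := by positivity
  linarith

theorem stirlingRatio_exponent_nonpos {p n k : ℕ} (hn : 0 < n) (hk : k ≤ n) :
    ((n - k : ℝ) * (Real.log n - Real.log (n - k)) - k) / p ≤ 0 := by
  refine div_nonpos_of_nonpos_of_nonneg ?_ (Nat.cast_nonneg p)
  rcases hk.eq_or_lt with rfl | hk
  · simp
  · have hk' : (0 : ℝ) < n - k := by rw [sub_pos]; exact_mod_cast hk
    have hn' : (0 : ℝ) < n := by exact_mod_cast hn
    have h := Real.log_le_sub_one_of_pos (div_pos hn' hk')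
    rw [Real.log_div hn'.ne' hk'.ne'] at h
    have h2 := mul_le_mul_of_nonneg_left h hk'.le
    have e : (n - k : ℝ) * (n / (n - k) - 1) = k := by field_simp; ring
    linarith

theorem div_exp_one_pow_div_factorial_le_one (j : ℕ) :
    (j / Real.exp 1 : ℝ) ^ j / (j.factorial : ℝ) ≤ 1 := by
  rw [div_le_one (by positivity), div_pow, div_le_iff₀ (by positivity), ← Real.exp_nat_mul, mul_one]
  have h := Real.pow_div_factorial_le_exp (j : ℝ) (Nat.cast_nonneg j) j
  rw [div_le_iff₀ (by positivity)] at h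
  linarith

theorem stirlingRatio_le_sqrt {p n k : ℕ} (hn : 0 < n) (hk : k ≤ n) :
    stirlingRatio p n k ≤ √(2 * Real.pi * n / p) := by
  unfold stirlingRatio
  have h1 := div_exp_one_pow_div_factorial_le_one ((n - k) / p)
  have h2 := Real.exp_le_one_iff.2 (stirlingRatio_exponent_nonpos (p := p) hn hk)
  rw [mul_assoc]
  exact mul_le_of_le_one_right (Real.sqrt_nonneg _) (mul_le_one₀ h1 (Real.exp_nonneg _) h2)

/-- Here `n ≤ 2pj`, so the square root is at most `2 √(2πj)`, and Stirling's lower bound for `j!`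
absorbs the rest. -/
theorem stirlingRatio_le_two {p n k : ℕ} (hp : 0 < p) (hn : 0 < n) (hk : 2 * k ≤ n)
    (hpk : p ∣ n - k) : stirlingRatio p n k ≤ 2 := by
  obtain ⟨j, hj⟩ := hpk
  have hdiv : (n - k) / p = j := by rw [hj, Nat.mul_div_cancel_left _ hp]
  have h2 := Real.exp_le_one_iff.2 (stirlingRatio_exponent_nonpos (p := p) (k := k) hn (by omega))
  unfold stirlingRatio
  rw [hdiv]
  refine (mul_le_of_le_one_right (by positivity) h2).trans ?_
  rw [← mul_div_assoc, div_le_iff₀ (by positivity)]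
  have h3 : √(2 * Real.pi * n / p) ≤ 2 * √(2 * Real.pi * j) := by
    rw [show (2 : ℝ) = √4 by rw [show (4 : ℝ) = 2 ^ 2 by norm_num]; simp, ← Real.sqrt_mul (by norm_num)]
    apply Real.sqrt_le_sqrt
    have : (n : ℝ) ≤ 2 * (p * j) := by exact_mod_cast (by omega : n ≤ 2 * (p * j))
    rw [div_le_iff₀ (by exact_mod_cast hp)]
    rw [show √4 = (2 : ℝ) by rw [show (4 : ℝ) = 2 ^ 2 by norm_num]; simp]
    nlinarith [mul_le_mul_of_nonneg_left this Real.pi_pos.le, mul_nonneg Real.pi_pos.le (Nat.cast_nonneg (α := ℝ) n)]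
  have h4 := Stirling.le_factorial_stirling j
  calc _ ≤ 2 * √(2 * Real.pi * j) * (j / Real.exp 1 : ℝ) ^ j := by gcongr
    _ ≤ _ := by linarith

/-- Along this filter `n → ∞` and `k / n ^ (1 / p) → 1` within the admissible pairs. -/
noncomputable def concentrationFilter (p : ℕ) : Filter (ℕ × ℕ) :=
  comap Prod.fst atTop ⊓ comap (fun q => (q.2 : ℝ) / (q.1 : ℝ) ^ (1 / p : ℝ)) (𝓝 1) ⊓
    𝓟 {q | q.2 ≤ q.1 ∧ p ∣ q.1 - q.2}

/-- With `x = k/n`, the exponent is `-k²/(2pn)` up to an error at most `(4/p) (k²/n) x`. Since `k ~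
n^(1/p)`, `k²/n` has the limit `d` of `n^(2/p-1)` and `x` tends to 0. -/
theorem tendsto_stirlingRatio {p : ℕ} (hp : 2 ≤ p) {d : ℝ}
    (hd : Tendsto (fun n : ℕ => (n : ℝ) ^ (2 / p - 1 : ℝ)) atTop (𝓝 d)) :
    Tendsto (fun q : ℕ × ℕ => stirlingRatio p q.1 q.2) (concentrationFilter p)
      (𝓝 (Real.exp (-(d / (2 * p))))) := by
  have hp' : (2 : ℝ) ≤ p := by exact_mod_cast hp
  have hn : Tendsto (fun q : ℕ × ℕ => q.1) (concentrationFilter p) atTop :=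
    tendsto_comap.mono_left (inf_le_left.trans inf_le_left)
  have hnr : Tendsto (fun q : ℕ × ℕ => (q.1 : ℝ)) (concentrationFilter p) atTop :=
    tendsto_natCast_atTop_atTop.comp hn
  have hk : Tendsto (fun q : ℕ × ℕ => (q.2 : ℝ) / (q.1 : ℝ) ^ (1 / p : ℝ))
      (concentrationFilter p) (𝓝 1) :=
    tendsto_comap.mono_left (inf_le_left.trans inf_le_right)
  have hmem : ∀ᶠ q in concentrationFilter p, q.2 ≤ q.1 ∧ p ∣ q.1 - q.2 :=
    mem_inf_of_right (mem_principal_self _)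
  have hx : Tendsto (fun q : ℕ × ℕ => (q.2 : ℝ) / q.1) (concentrationFilter p) (𝓝 0) := by
    have h1 : Tendsto (fun q : ℕ × ℕ => (q.1 : ℝ) ^ (-(1 - 1 / p : ℝ)))
        (concentrationFilter p) (𝓝 0) := by
      refine (tendsto_rpow_neg_atTop ?_).comp hnr
      rw [sub_pos, div_lt_one] <;> linarith
    have h2 := hk.mul h1
    rw [mul_zero] at h2
    refine h2.congr' ?_
    filter_upwards [hnr.eventually_gt_atTop 0] with q hq
    rw [div_mul_eq_mul_div, div_eq_div_iff (by positivity) hq.ne', mul_assoc]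
    congr 1
    nth_rw 2 [← Real.rpow_one (q.1 : ℝ)]
    rw [← Real.rpow_add hq]
    congr 1; ring
  have hx2 : Tendsto (fun q : ℕ × ℕ => (q.2 : ℝ) ^ 2 / q.1) (concentrationFilter p) (𝓝 d) := by
    have h2 := (hk.pow 2).mul (hd.comp hn)
    rw [one_pow, one_mul] at h2
    refine h2.congr' ?_
    filter_upwards [hnr.eventually_gt_atTop 0] with q hq
    simp only [Function.comp]
    rw [div_pow, div_mul_eq_mul_div, div_eq_div_iff (by positivity) hq.ne', mul_assoc]
    congr 1
    nth_rw 2 [← Real.rpow_one (q.1 : ℝ)]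
    rw [← Real.rpow_add hq, ← Real.rpow_mul_natCast hq.le]
    congr 1; push_cast; ring
  have hjr : ∀ᶠ q : ℕ × ℕ in concentrationFilter p,
      (((q.1 - q.2) / p : ℕ) : ℝ) = q.1 * ((1 - (q.2 : ℝ) / q.1) / p) := by
    filter_upwards [hmem, hnr.eventually_gt_atTop 0] with q hq hq0
    rw [Nat.cast_div hq.2 (by positivity), Nat.cast_sub hq.1]
    field_simp
  have hx1 : Tendsto (fun q : ℕ × ℕ => 1 - (q.2 : ℝ) / q.1) (concentrationFilter p) (𝓝 1) := by
    simpa using hx.const_sub 1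
  have hj : Tendsto (fun q : ℕ × ℕ => (q.1 - q.2) / p) (concentrationFilter p) atTop := by
    rw [← tendsto_natCast_atTop_iff (R := ℝ)]
    refine Tendsto.congr' (hjr.mono fun _ h => h.symm) ?_
    exact hnr.atTop_mul_pos (C := 1 / p) (by positivity) (hx1.div_const _)
  have hst : Tendsto (fun q : ℕ × ℕ => √(2 * Real.pi * q.1 / p) *
      ((((q.1 - q.2) / p : ℕ) / Real.exp 1 : ℝ) ^ ((q.1 - q.2) / p) /
        (((q.1 - q.2) / p).factorial : ℝ))) (concentrationFilter p) (𝓝 1) := by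
    have h1 := ((Asymptotics.isEquivalent_iff_tendsto_one (by
      filter_upwards with j
      positivity)).1 Stirling.factorial_isEquivalent_stirling.symm).comp hj
    -- Stirling's formula for `j!` involves `2πj` instead of `2πn/p`; their quotient is `1 - k/n`,
    -- which tends to 1.
    have h2 := h1.mul (((Real.continuous_sqrt.tendsto 1).comp
      (by simpa using hx1.inv₀ one_ne_zero : Tendsto (fun q : ℕ × ℕ =>
        (1 - (q.2 : ℝ) / q.1)⁻¹) (concentrationFilter p) (𝓝 1))))
    rw [Real.sqrt_one, mul_one] at h2
    refine h2.congr' ?_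
    filter_upwards [hjr, hnr.eventually_gt_atTop 0, hx1.eventually_const_lt zero_lt_one]
      with q hq hq0 hq1
    have e : √(2 * Real.pi * q.1 / p) = √(2 * (((q.1 - q.2) / p : ℕ) : ℝ) * Real.pi) *
        √((1 - (q.2 : ℝ) / q.1)⁻¹) := by
      rw [← Real.sqrt_mul (by positivity), hq]
      congr 1
      have hy := hq1.ne'
      generalize 1 - (q.2 : ℝ) / q.1 = y at hy ⊢
      field_simp
    simp only [Function.comp, Pi.div_apply]
    rw [e]
    ring
  have hex : Tendsto (fun q : ℕ × ℕ =>
      ((q.1 - q.2 : ℝ) * (Real.log q.1 - Real.log (q.1 - q.2)) - q.2) / p)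
      (concentrationFilter p) (𝓝 (-(d / (2 * p)))) := by
    have hz : Tendsto (fun q : ℕ × ℕ => 4 / (p : ℝ) * ((q.2 : ℝ) ^ 2 / q.1 * |(q.2 : ℝ) / q.1|))
        (concentrationFilter p) (𝓝 0) := by
      have h := (hx2.mul hx.abs).const_mul (4 / (p : ℝ))
      rwa [abs_zero, mul_zero, mul_zero] at h
    have hz' : Tendsto (fun q : ℕ × ℕ =>
        ((q.1 - q.2 : ℝ) * (Real.log q.1 - Real.log (q.1 - q.2)) - q.2) / p +
          (q.2 : ℝ) ^ 2 / q.1 / (2 * p)) (concentrationFilter p) (𝓝 0) := by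
      refine squeeze_zero_norm' ?_ hz
      filter_upwards [hnr.eventually_gt_atTop 0, hx1.eventually_const_lt zero_lt_one,
        hx.abs.eventually_le_const (u := 1 / 2) (by norm_num)] with q hq0 hq1 hq2
      have e1 : (q.1 - q.2 : ℝ) = q.1 * (1 - (q.2 : ℝ) / q.1) := by field_simp
      have e2 : ((q.1 - q.2 : ℝ) * (Real.log q.1 - Real.log (q.1 - q.2)) - q.2) / p +
          (q.2 : ℝ) ^ 2 / q.1 / (2 * p) =
          (q.1 : ℝ) / p * ((-(1 - (q.2 : ℝ) / q.1) * Real.log (1 - (q.2 : ℝ) / q.1) -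
            (q.2 : ℝ) / q.1) + ((q.2 : ℝ) / q.1) ^ 2 / 2) := by
        rw [e1, Real.log_mul hq0.ne' hq1.ne']
        field_simp
        ring
      rw [e2, Real.norm_eq_abs, abs_mul, abs_of_pos (by positivity)]
      refine (mul_le_mul_of_nonneg_left (abs_one_sub_mul_log_one_sub_le hq2)
        (by positivity)).trans (le_of_eq ?_)
      rw [pow_succ |(q.2 : ℝ) / q.1|, sq_abs]
      field_simp
    have h := hz'.sub (hx2.div_const (2 * (p : ℝ)))
    rw [zero_sub] at h
    exact h.congr fun q => by ring
  have h := hst.mul ((Real.continuous_exp.tendsto _).comp hex)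
  rw [one_mul] at h
  exact h

/-- Near `k = n^(1/p)` the limit gives `ε`. Elsewhere the crude bounds on the ratio suffice, since
the squared relative deviation is bounded below. -/
theorem exists_abs_stirlingRatio_sub_le {p : ℕ} (hp : 2 ≤ p) {d : ℝ}
    (hd : Tendsto (fun n : ℕ => (n : ℝ) ^ (2 / p - 1 : ℝ)) atTop (𝓝 d)) {ε : ℝ} (hε : 0 < ε) :
    ∃ M, 0 ≤ M ∧ ∀ᶠ n : ℕ in atTop, ∀ k, k ≡ n [MOD p] →
      |(if k ≤ n then stirlingRatio p n k else 0) - Real.exp (-(d / (2 * p)))| ≤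
        ε + M * (((k : ℝ) - (n : ℝ) ^ (1 / p : ℝ)) ^ 2 / ((n : ℝ) ^ (1 / p : ℝ)) ^ 2) := by
  set c := Real.exp (-(d / (2 * p))) with hc
  have hp' : (2 : ℝ) ≤ p := by exact_mod_cast hp
  have hev := (Metric.tendsto_nhds.1 (tendsto_stirlingRatio hp hd)) ε hε
  rw [concentrationFilter, ((((atTop_basis (α := ℕ)).comap Prod.fst).inf
    (Metric.nhds_basis_ball.comap _)).inf_principal _).eventually_iff] at hev
  obtain ⟨⟨N, δ⟩, ⟨-, hδ⟩, hev⟩ := hev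
  simp only at hδ
  set B := 2 + |c| with hB
  have hB0 : 0 ≤ B := by positivity
  -- `B / δ²` covers `k` away from `n^(1/p)`, 32 pays for the bound of order `√n` when `k > n/2`,
  -- and `B` covers `k > n`.
  refine ⟨B / δ ^ 2 + 32 + B, by positivity, ?_⟩
  filter_upwards [eventually_ge_atTop N, eventually_ge_atTop 16] with n hnN hn16 k hkn
  have hn0 : (16 : ℝ) ≤ n := by exact_mod_cast hn16
  set l := (n : ℝ) ^ (1 / p : ℝ) with hl
  have hl0 : 0 < l := by positivity
  have hls : l ≤ √n := by
    rw [Real.sqrt_eq_rpow]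
    exact Real.rpow_le_rpow_of_exponent_le (by linarith)
      (one_div_le_one_div_of_le two_pos hp')
  have hss : √(n : ℝ) * √n = n := Real.mul_self_sqrt (by positivity)
  have hs4 : 4 ≤ √(n : ℝ) := Real.le_sqrt_of_sq_le (by linarith)
  have hl4 : l ≤ n / 4 := by nlinarith
  have hl2 : l ^ 2 ≤ n := by nlinarith
  set X := ((k : ℝ) - l) ^ 2 / l ^ 2 with hX
  have hX0 : 0 ≤ X := by positivity
  have hexp : (B / δ ^ 2 + 32 + B) * X = B / δ ^ 2 * X + 32 * X + B * X := by ring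
  have h1 : 0 ≤ B / δ ^ 2 * X := by positivity
  have h2 : 0 ≤ B * X := by positivity
  rw [hexp]
  have habs : ∀ t : ℝ, 0 ≤ t → |t - c| ≤ t + |c| := fun t ht =>
    (abs_sub _ _).trans (by rw [abs_of_nonneg ht])
  have hn1 : 0 < n := by omega
  split_ifs with hk
  · have hdvd : p ∣ n - k := (Nat.modEq_iff_dvd' hk).1 hkn
    by_cases hnear : |(k : ℝ) / l - 1| < δ
    · have := @hev (n, k) ⟨⟨hnN, (Real.dist_eq _ _).trans_lt hnear⟩, hk, hdvd⟩
      rw [Real.dist_eq] at this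
      have := this.le
      linarith
    · have hXδ : δ ^ 2 ≤ X := by
        have e : X = |(k : ℝ) / l - 1| ^ 2 := by
          rw [sq_abs, hX]; field_simp
        rw [e]
        exact pow_le_pow_left₀ hδ.le (not_lt.1 hnear) 2
      have h3 : B ≤ B / δ ^ 2 * X := by
        rw [div_mul_eq_mul_div, le_div_iff₀ (by positivity)]
        exact mul_le_mul_of_nonneg_left hXδ hB0
      refine (habs _ (stirlingRatio_nonneg _ _ _)).trans ?_
      by_cases hk2 : 2 * k ≤ n
      · have := stirlingRatio_le_two (by omega) hn1 hk2 hdvd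
        linarith
      · have h4 := stirlingRatio_le_sqrt (p := p) hn1 hk
        have h5 : √(2 * Real.pi * n / p) ≤ 2 * √n := by
          rw [Real.sqrt_le_left (by positivity), mul_pow, Real.sq_sqrt (by positivity),
            div_le_iff₀ (by positivity)]
          have := Real.pi_le_four
          have : Real.pi * n ≤ 4 * n := by gcongr
          nlinarith
        -- `k ≥ n/2` and `l ≤ n/4` give `k - l ≥ n/4`, while `l² ≤ n`.
        have h6 : (n : ℝ) ≤ 16 * X := by
          have hk2' : (n : ℝ) ≤ 2 * k := by exact_mod_cast (not_le.1 hk2).le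
          rw [hX, ← mul_div_assoc, le_div_iff₀ (by positivity)]
          nlinarith
        nlinarith
  · have hk' : (n : ℝ) ≤ k := by exact_mod_cast (not_le.1 hk).le
    have h3 : 1 ≤ X := by
      rw [hX, one_le_div (by positivity)]
      apply pow_le_pow_left₀ hl0.le
      linarith
    rw [zero_sub, abs_neg]
    nlinarith [abs_nonneg c]

/-- Asymptotics of the number of solutions of `σ ^ p = 1` in the symmetric group. -/
theorem tendsto_powOneCount_div {p : ℕ} [hpp : Fact p.Prime] {d : ℝ}
    (hd : Tendsto (fun n : ℕ => (n : ℝ) ^ (2 / p - 1 : ℝ)) atTop (𝓝 d)) :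
    Tendsto (fun n : ℕ => (powOneCount p n : ℝ) / n.factorial /
      (stirlingScale p n * Real.exp ((n : ℝ) ^ (1 / p : ℝ)))) atTop
      (𝓝 (Real.exp (-(d / (2 * p))) / p)) := by
  have hp := hpp.out.two_le
  have hp' : (2 : ℝ) ≤ p := by exact_mod_cast hp
  have hlam : Tendsto (fun n : ℕ => (n : ℝ) ^ (1 / p : ℝ)) atTop atTop :=
    (tendsto_rpow_atTop (by positivity)).comp tendsto_natCast_atTop_atTop
  have h := tendsto_tsum_residueIndicator_mul_poissonWeight hlam hpp.out.pos (fun n => n)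
    (fun n k => if k ≤ n then stirlingRatio p n k else 0) (Real.exp (-(d / (2 * p))))
    (fun ε hε => exists_abs_stirlingRatio_sub_le hp hd hε)
  refine h.congr' ?_
  filter_upwards [eventually_gt_atTop 0] with n hn
  have hn' : (0 : ℝ) < n := by exact_mod_cast hn
  have hpos : 0 < stirlingScale p n * Real.exp ((n : ℝ) ^ (1 / p : ℝ)) := by
    unfold stirlingScale; positivity
  rw [eq_div_iff hpos.ne', powOneCount_div_factorial, tsum_eq_sum (s := range (n + 1)), sum_mul]
  · refine sum_congr rfl fun k hk => ?_
    have hk : k ≤ n := Nat.lt_succ_iff.1 (mem_range.1 hk)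
    rw [if_pos hk, residueIndicator]
    by_cases hdvd : p ∣ n - k
    · rw [if_pos hdvd, if_pos ((Nat.modEq_iff_dvd' hk).2 hdvd),
        inv_eq_stirlingScale_mul hpp.out.pos hn hk hdvd]
      ring
    · rw [if_neg hdvd, if_neg fun h => hdvd ((Nat.modEq_iff_dvd' hk).1 h)]
      ring
  · intro k hk
    rw [if_neg fun h => hk (mem_range.2 (Nat.lt_succ_of_le h))]
    ring

/-! ### Growth of the normalised homomorphism count and its convolution. -/

/-- The growth scale of the normalised number of representations of the modular group. -/
noncomputable def modularScale (n : ℕ) : ℝ :=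
  Real.exp ((n : ℝ) / 6 * (Real.log n - 1) + (n : ℝ) ^ (1 / 2 : ℝ) + (n : ℝ) ^ (1 / 3 : ℝ)) / √n

theorem tendsto_powOneCount_two_mul_three_div :
    Tendsto (fun n : ℕ => (powOneCount 2 n * powOneCount 3 n : ℝ) / n.factorial / modularScale n)
      atTop (𝓝 (Real.exp (-(1 / 4)) / √(12 * Real.pi))) := by
  have h2 := tendsto_powOneCount_div (p := 2) (d := 1) (by simp)
  have h3 := tendsto_powOneCount_div (p := 3) (d := 0) (by
    have := (tendsto_rpow_neg_atTop (y := 1 / 3) (by norm_num)).comp tendsto_natCast_atTop_atTop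
    convert this using 3
    norm_num)
  have hf := (Asymptotics.isEquivalent_iff_tendsto_one (by
      filter_upwards [eventually_gt_atTop 0] with n hn
      positivity)).1 Stirling.factorial_isEquivalent_stirling
  -- The factor `√(3/π)` is what remains of the square roots in Stirling's formula and the two
  -- scales after a `√n` is set aside for `modularScale`.
  have h := ((h2.mul h3).mul hf).mul_const (√(3 / Real.pi))
  have hc : Real.exp (-(1 / (2 * (2 : ℕ)))) / (2 : ℕ) * (Real.exp (-(0 / (2 * (3 : ℕ)))) / (3 : ℕ))
      * 1 * √(3 / Real.pi) = Real.exp (-(1 / 4)) / √(12 * Real.pi) := by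
    have e : √(12 * Real.pi) * √(3 / Real.pi) = 6 := by
      rw [← Real.sqrt_mul (by positivity), show 12 * Real.pi * (3 / Real.pi) = 6 ^ 2 by
        field_simp; norm_num, Real.sqrt_sq (by norm_num)]
    rw [eq_div_iff (by positivity), mul_assoc, mul_comm √(3 / Real.pi), e]
    norm_num
    ring
  rw [hc] at h
  refine h.congr' ?_
  filter_upwards [eventually_gt_atTop 0] with n hn
  have hn' : (0 : ℝ) < n := by exact_mod_cast hn
  have hpow : ((n : ℝ) / Real.exp 1) ^ n = Real.exp (n * (Real.log n - 1)) := by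
    rw [Real.exp_nat_mul, Real.exp_sub, Real.exp_log hn']
  have hsq : √(2 * n * Real.pi) * √n = √(2 * Real.pi * n / (2 : ℕ)) *
      √(2 * Real.pi * n / (3 : ℕ)) * √(3 / Real.pi) := by
    rw [← Real.sqrt_mul (by positivity), ← Real.sqrt_mul (by positivity),
      ← Real.sqrt_mul (by positivity)]
    congr 1
    push_cast
    field_simp
  have hexp : Real.exp (-((n : ℝ) / (2 : ℕ) * (Real.log n - 1))) *
      Real.exp (-((n : ℝ) / (3 : ℕ) * (Real.log n - 1))) * Real.exp (n * (Real.log n - 1)) =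
      Real.exp ((n : ℝ) / 6 * (Real.log n - 1)) := by
    rw [← Real.exp_add, ← Real.exp_add]
    congr 1
    push_cast
    ring
  simp only [Pi.div_apply, modularScale, stirlingScale]
  rw [hpow, Real.exp_add, Real.exp_add, ← hexp]
  have p1 : 0 < √(2 * n * Real.pi) := by positivity
  have p2 : 0 < √(2 * Real.pi * n / (2 : ℕ)) := by positivity
  have p3 : 0 < √(2 * Real.pi * n / (3 : ℕ)) := by positivity
  have p4 : 0 < √(n : ℝ) := by positivity
  have p5 : 0 < √(3 / Real.pi) := by positivity
  have p6 : (n.factorial : ℝ) ≠ 0 := by positivity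
  generalize √(2 * n * Real.pi) = s1 at *
  generalize √(2 * Real.pi * n / (2 : ℕ)) = s2 at *
  generalize √(2 * Real.pi * n / (3 : ℕ)) = s3 at *
  generalize √(3 / Real.pi) = s4 at *
  push_cast at *
  field_simp
  linear_combination (-powOneCount 2 n * powOneCount 3 n : ℝ) * hsq

theorem modularScale_pos {n : ℕ} (hn : 0 < n) : 0 < modularScale n := by
  have : (0 : ℝ) < n := by exact_mod_cast hn
  unfold modularScale; positivity

/-- A bound for `modularScale k * modularScale (n - k) / modularScale n`. -/
noncomputable def modularDecay (n k : ℕ) : ℝ :=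
  Real.exp ((k : ℝ) ^ (1 / 2 : ℝ) + (k : ℝ) ^ (1 / 3 : ℝ) -
    (k : ℝ) / 6 * (Real.log n - Real.log k))

theorem modularScale_mul_le {n k : ℕ} (hk : 0 < k) (hkn : 2 * k ≤ n) :
    modularScale k * modularScale (n - k) ≤ 2 * modularDecay n k * modularScale n := by
  have hk' : (0 : ℝ) < k := by exact_mod_cast hk
  have hkn' : 2 * (k : ℝ) ≤ n := by exact_mod_cast hkn
  have hn' : (0 : ℝ) < n := by linarith
  have hcast : ((n - k : ℕ) : ℝ) = n - k := Nat.cast_sub (by omega)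
  have hm : (0 : ℝ) < n - k := by linarith
  unfold modularScale modularDecay
  rw [hcast, div_mul_div_comm, ← Real.exp_add, ← mul_div_assoc, mul_assoc 2, ← Real.exp_add,
    div_le_div_iff₀ (by positivity) (by positivity)]
  have h1 : √(n : ℝ) ≤ 2 * (√(k : ℝ) * √(n - k : ℝ)) := by
    rw [← Real.sqrt_mul hk'.le, Real.sqrt_le_left (by positivity), mul_pow,
      Real.sq_sqrt (by positivity)]
    have : (1 : ℝ) ≤ k := by exact_mod_cast hk
    nlinarith
  have hlog : Real.log (n - k) ≤ Real.log n := Real.log_le_log hm (by linarith)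
  have h2 : (n - k : ℝ) ^ (1 / 2 : ℝ) ≤ (n : ℝ) ^ (1 / 2 : ℝ) :=
    Real.rpow_le_rpow hm.le (by linarith) (by norm_num)
  have h3 : (n - k : ℝ) ^ (1 / 3 : ℝ) ≤ (n : ℝ) ^ (1 / 3 : ℝ) :=
    Real.rpow_le_rpow hm.le (by linarith) (by norm_num)
  rw [mul_right_comm, mul_comm]
  refine mul_le_mul h1 (Real.exp_le_exp.2 ?_) (Real.exp_nonneg _) (by positivity)
  nlinarith

/-- As `n/k ≥ 2`, the linear term is at least `0.69 k/6`, which beats the two roots, together at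
most `2√k`. -/
theorem modularDecay_le {n k : ℕ} (hk : 0 < k) (hkn : 2 * k ≤ n) :
    modularDecay n k ≤ Real.exp (20 : ℝ) * Real.exp (-(1 / 20)) ^ k := by
  have hk' : (1 : ℝ) ≤ k := by exact_mod_cast hk
  have hkn' : 2 * (k : ℝ) ≤ n := by exact_mod_cast hkn
  rw [← Real.exp_nat_mul, ← Real.exp_add]
  apply Real.exp_le_exp.2
  have h1 : Real.log 2 + Real.log k ≤ Real.log n := by
    rw [← Real.log_mul (by norm_num) (by positivity)]
    exact Real.log_le_log (by positivity) hkn'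
  have h2 := Real.log_two_gt_d9
  have h3 : (k : ℝ) ^ (1 / 3 : ℝ) ≤ (k : ℝ) ^ (1 / 2 : ℝ) :=
    Real.rpow_le_rpow_of_exponent_le hk' (by norm_num)
  have h4 : (k : ℝ) ^ (1 / 2 : ℝ) * (k : ℝ) ^ (1 / 2 : ℝ) = k := by
    rw [← Real.rpow_add (by positivity)]; norm_num
  have h5 : (k : ℝ) / 6 * 0.69 ≤ (k : ℝ) / 6 * (Real.log n - Real.log k) := by
    gcongr
    linarith
  -- The square yields `2√k ≤ 20 + k/20`, and `0.69/6 > 1/20 + 1/20`.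
  nlinarith [sq_nonneg ((k : ℝ) ^ (1 / 2 : ℝ) - 20)]

theorem tendsto_modularDecay {k : ℕ} (hk : 0 < k) :
    Tendsto (fun n => modularDecay n k) atTop (𝓝 0) := by
  have hk' : (0 : ℝ) < k := by exact_mod_cast hk
  refine Real.tendsto_exp_atBot.comp ?_
  have h : Tendsto (fun n : ℕ => (k : ℝ) / 6 * (Real.log n - Real.log k)) atTop atTop :=
    (tendsto_atTop_add_const_right _ _
      (Real.tendsto_log_atTop.comp tendsto_natCast_atTop_atTop)).const_mul_atTop (by positivity)
  exact tendsto_atBot_add_const_left _ _ (tendsto_neg_atTop_atBot.comp h)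

/-- Sequences growing like `modularScale` have negligible interior convolution. -/
theorem tendsto_sum_Ioo_mul_div {a : ℕ → ℝ} (ha : ∀ n, 0 < a n) {L : ℝ} (hL : 0 < L)
    (h : Tendsto (fun n => a n / modularScale n) atTop (𝓝 L)) :
    Tendsto (fun n => (∑ k ∈ Ioo 0 n, a k * a (n - k)) / a n) atTop (𝓝 0) := by
  obtain ⟨C, hC⟩ := h.bddAbove_range
  obtain ⟨D, hD⟩ := (h.inv₀ hL.ne').bddAbove_range
  have hup (n : ℕ) (hn : 0 < n) : a n ≤ C * modularScale n := by
    rw [← div_le_iff₀ (modularScale_pos hn)]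
    exact hC ⟨n, rfl⟩
  have hlow (n : ℕ) (hn : 0 < n) : modularScale n ≤ D * a n := by
    rw [← div_le_iff₀ (ha n)]
    simpa using hD ⟨n, rfl⟩
  have hC0 : 0 ≤ C := (div_pos (ha 1) (modularScale_pos one_pos)).le.trans (hC ⟨1, rfl⟩)
  set K := C ^ 2 * 2 * D with hK
  have hD0 : 0 ≤ D :=
    (inv_pos.2 (div_pos (ha 1) (modularScale_pos one_pos))).le.trans (hD ⟨1, rfl⟩)
  have hK0 : 0 ≤ K := by positivity
  -- The sum is symmetric under `k ↦ n - k`, so it is at most twice its part with `2k ≤ n`. That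
  -- half is treated by dominated convergence, with a geometric majorant.
  set f : ℕ → ℕ → ℝ := fun n k => if 0 < k ∧ 2 * k ≤ n then a k * a (n - k) / a n else 0 with hf
  have hf0 (n k : ℕ) : 0 ≤ f n k := by
    simp only [hf]
    split_ifs
    · exact div_nonneg (mul_nonneg (ha _).le (ha _).le) (ha _).le
    · exact le_rfl
  have hfle (n k : ℕ) (hk : 0 < k) : f n k ≤ K * modularDecay n k := by
    have hd : 0 ≤ modularDecay n k := (Real.exp_pos _).le
    simp only [hf]
    split_ifs with hkn
    · rw [div_le_iff₀ (ha n)]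
      calc a k * a (n - k) ≤ (C * modularScale k) * (C * modularScale (n - k)) :=
            mul_le_mul (hup k hk) (hup _ (by omega)) (ha _).le
              (mul_nonneg hC0 (modularScale_pos hk).le)
        _ = C ^ 2 * (modularScale k * modularScale (n - k)) := by ring
        _ ≤ C ^ 2 * (2 * modularDecay n k * modularScale n) := by
            exact mul_le_mul_of_nonneg_left (modularScale_mul_le hk hkn.2) (sq_nonneg C)
        _ ≤ C ^ 2 * (2 * modularDecay n k * (D * a n)) := by
            gcongr; exact hlow n (by omega)
        _ = K * modularDecay n k * a n := by rw [hK]; ring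
    · positivity
  have ht : Tendsto (fun n => ∑' k, f n k) atTop (𝓝 (∑' _ : ℕ, (0 : ℝ))) := by
    refine tendsto_tsum_of_dominated_convergence
      (bound := fun k => K * (Real.exp (20 : ℝ) * Real.exp (-(1 / 20)) ^ k)) ?_ ?_ ?_
    · refine Summable.mul_left _ (Summable.mul_left _ (summable_geometric_of_lt_one
        (Real.exp_nonneg _) ?_))
      rw [Real.exp_lt_one_iff]; norm_num
    · intro k
      rcases Nat.eq_zero_or_pos k with rfl | hk
      · simp [hf]
      · refine squeeze_zero (fun n => hf0 n k) (fun n => hfle n k hk) ?_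
        simpa using (tendsto_modularDecay hk).const_mul K
    · refine Eventually.of_forall fun n k => ?_
      rw [Real.norm_of_nonneg (hf0 n k)]
      by_cases hkn : 0 < k ∧ 2 * k ≤ n
      · exact (hfle n k hkn.1).trans (by gcongr; exact modularDecay_le hkn.1 hkn.2)
      · simp only [hf, if_neg hkn]
        positivity
  rw [tsum_zero] at ht
  have ht2 := ht.const_mul 2
  rw [mul_zero] at ht2
  refine squeeze_zero (fun n => div_nonneg (sum_nonneg fun k _ =>
    mul_nonneg (ha _).le (ha _).le) (ha _).le) (fun n => ?_) ht2
  have hts : ∑' k, f n k = ∑ k ∈ Ioo 0 n, f n k := by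
    refine tsum_eq_sum fun k hk => if_neg ?_
    rw [mem_Ioo] at hk
    omega
  have hrefl : ∑ k ∈ Ioo 0 n, f n (n - k) = ∑ k ∈ Ioo 0 n, f n k := by
    refine sum_nbij' (fun k => n - k) (fun k => n - k) ?_ ?_ ?_ ?_ ?_ <;>
      · intro k hk
        simp only [mem_Ioo] at hk ⊢
        try omega
  rw [hts, two_mul]
  nth_rw 1 [← hrefl]
  rw [← sum_add_distrib, sum_div]
  refine sum_le_sum fun k hk => ?_
  rw [mem_Ioo] at hk
  rcases le_total (2 * k) n with hkn | hkn
  · have : f n k = a k * a (n - k) / a n := if_pos ⟨hk.1, hkn⟩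
    linarith [hf0 n (n - k)]
  · have : f n (n - k) = a (n - k) * a (n - (n - k)) / a n := if_pos ⟨by omega, by omega⟩
    rw [Nat.sub_sub_self hk.2.le, mul_comm (a (n - k))] at this
    linarith [hf0 n k]

/-! ### Almost all representations are transitive, and the final asymptotics. -/

/-- If the interior convolution of `permHomCount Γ n / n!` is negligible, almost all
representations are transitive. -/
theorem tendsto_card_index_div {Γ : Type*} [Group Γ] [∀ n, Finite (Γ →* Equiv.Perm (Fin n))]
    (h : Tendsto (fun n => (∑ k ∈ Ioo 0 n, (permHomCount Γ k / k.factorial : ℝ) *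
      (permHomCount Γ (n - k) / (n - k).factorial)) / (permHomCount Γ n / n.factorial))
      atTop (𝓝 0)) :
    Tendsto (fun n : ℕ => (Nat.card {H : Subgroup Γ // H.index = n} : ℝ) /
      (n * (permHomCount Γ n / n.factorial))) atTop (𝓝 1) := by
  have hpos (n : ℕ) : (0 : ℝ) < permHomCount Γ n := by
    exact_mod_cast Nat.card_pos
  have hlim : Tendsto (fun n : ℕ => (transitiveHomCount Γ n : ℝ) / permHomCount Γ n) atTop
      (𝓝 1) := by
    have h1 := h.const_sub 1
    rw [sub_zero] at h1
    refine tendsto_of_tendsto_of_tendsto_of_le_of_le h1 tendsto_const_nhds (fun n => ?_)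
      fun n => ?_
    · have h2 : (permHomCount Γ n : ℝ) ≤ transitiveHomCount Γ n +
          ∑ k ∈ Ioo 0 n, (n.choose k : ℝ) * (permHomCount Γ k * permHomCount Γ (n - k)) := by
        exact_mod_cast permHomCount_le_add (Γ := Γ) n
      -- Dividing by factorials turns the binomial convolution into an ordinary one.
      have h3 : ∑ k ∈ Ioo 0 n, (n.choose k : ℝ) * (permHomCount Γ k * permHomCount Γ (n - k)) =
          n.factorial * ∑ k ∈ Ioo 0 n, (permHomCount Γ k / k.factorial : ℝ) *
            (permHomCount Γ (n - k) / (n - k).factorial) := by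
        rw [mul_sum]
        refine sum_congr rfl fun k hk => ?_
        rw [Nat.cast_choose ℝ (mem_Ioo.1 hk).2.le]
        field_simp
      rw [h3] at h2
      simp only
      rw [div_div_eq_mul_div, sub_le_iff_le_add, ← add_div, le_div_iff₀ (hpos n), one_mul]
      linarith
    · exact div_le_one_of_le₀ (Nat.cast_le.2 transitiveHomCount_le) (hpos n).le
  refine hlim.congr' ?_
  filter_upwards [eventually_gt_atTop 0] with n hn
  have hn' : (0 : ℝ) < n := by exact_mod_cast hn
  have h1 : (n : ℝ) * transitiveHomCount Γ n =
      n.factorial * Nat.card {H : Subgroup Γ // H.index = n} := by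
    exact_mod_cast mul_transitiveHomCount Γ hn.ne'
  have := (hpos n).ne'
  field_simp
  linear_combination h1

theorem permHomCount_modular (n : ℕ) :
    permHomCount (Matrix.ProjectiveSpecialLinearGroup (Fin 2) ℤ) n =
      powOneCount 2 n * powOneCount 3 n := by
  rw [permHomCount, Nat.card_congr (ModularGroup.homEquiv _), Nat.card_prod]
  rfl

instance finite_hom_modular (n : ℕ) :
    Finite (Matrix.ProjectiveSpecialLinearGroup (Fin 2) ℤ →* Equiv.Perm (Fin n)) :=
  Finite.of_equiv _ (ModularGroup.homEquiv _).symm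

/-- Asymptotics of the number of subgroups of index `n` of the modular group. -/
theorem tendsto_card_modular_index_div :
    Tendsto (fun n : ℕ => (Nat.card {H : Subgroup (Matrix.ProjectiveSpecialLinearGroup (Fin 2) ℤ) //
      H.index = n} : ℝ) / (Real.exp (-(1 / 4)) / √(12 * Real.pi) * (n * modularScale n)))
      atTop (𝓝 1) := by
  set Γ := Matrix.ProjectiveSpecialLinearGroup (Fin 2) ℤ
  have hpos (n : ℕ) : (0 : ℝ) < permHomCount Γ n / n.factorial := by
    have : 0 < permHomCount Γ n := Nat.card_pos
    positivity
  have hL : 0 < Real.exp (-(1 / 4)) / √(12 * Real.pi) := by positivity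
  have ha : Tendsto (fun n : ℕ => (permHomCount Γ n / n.factorial : ℝ) / modularScale n) atTop
      (𝓝 (Real.exp (-(1 / 4)) / √(12 * Real.pi))) := by
    refine tendsto_powOneCount_two_mul_three_div.congr fun n => ?_
    rw [permHomCount_modular, Nat.cast_mul]
  have h := (tendsto_card_index_div (tendsto_sum_Ioo_mul_div hpos hL ha)).mul
    (ha.div_const (Real.exp (-(1 / 4)) / √(12 * Real.pi)))
  rw [div_self hL.ne', one_mul] at h
  refine h.congr' ?_
  filter_upwards [eventually_gt_atTop 0] with n hn
  have hn' : (n : ℝ) ≠ 0 := by positivity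
  have h1 := (hpos n).ne'
  have h2 := (modularScale_pos hn).ne'
  generalize (permHomCount Γ n / n.factorial : ℝ) = b at *
  generalize modularScale n = s at *
  field_simp
  rfl

theorem mainTheorem5 :
    -- for every `n ≥ 1` there are finitely many subgroups of index `n`
    (∀ n : ℕ, 1 ≤ n →
      Finite {H : Subgroup (Matrix.ProjectiveSpecialLinearGroup (Fin 2) ℤ) // H.index = n}) ∧
    Asymptotics.IsEquivalent Filter.atTop
      (fun n : ℕ =>
        (Nat.card {H : Subgroup (Matrix.ProjectiveSpecialLinearGroup (Fin 2) ℤ) //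
          H.index = n} : ℝ))
      (fun n : ℕ =>
        Real.exp (-(1 / 4)) * (n : ℝ) ^ (1 / 2 : ℝ) / Real.sqrt (12 * Real.pi)
          * (n : ℝ) ^ ((n : ℝ) / 6)
          * Real.exp (-((n : ℝ) / 6) + (n : ℝ) ^ (1 / 2 : ℝ) + (n : ℝ) ^ (1 / 3 : ℝ))) ∧
    -- Newman's form of the same asymptotic equivalent
    Asymptotics.IsEquivalent Filter.atTop
      (fun n : ℕ =>
        (Nat.card {H : Subgroup (Matrix.ProjectiveSpecialLinearGroup (Fin 2) ℤ) //
          H.index = n} : ℝ))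
      (fun n : ℕ =>
        (12 * Real.pi * Real.exp (1 / 2)) ^ (-(1 / 2) : ℝ)
          * Real.exp (1 / 6 * (n : ℝ) * Real.log n - 1 / 6 * (n : ℝ)
              + (n : ℝ) ^ (1 / 2 : ℝ) + (n : ℝ) ^ (1 / 3 : ℝ) + 1 / 2 * Real.log n)) := by
  have hmain : Asymptotics.IsEquivalent Filter.atTop
      (fun n : ℕ =>
        (Nat.card {H : Subgroup (Matrix.ProjectiveSpecialLinearGroup (Fin 2) ℤ) //
          H.index = n} : ℝ))
      (fun n : ℕ => Real.exp (-(1 / 4)) / √(12 * Real.pi) * (n * modularScale n)) := by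
    refine (Asymptotics.isEquivalent_iff_tendsto_one ?_).2 tendsto_card_modular_index_div
    filter_upwards [eventually_gt_atTop 0] with n hn
    have := modularScale_pos hn
    positivity
  have hsqrt {n : ℕ} (hn : 0 < n) : (n : ℝ) / √n = (n : ℝ) ^ (1 / 2 : ℝ) := by
    rw [Real.div_sqrt, Real.sqrt_eq_rpow]
  refine ⟨fun n hn => finite_subgroup_index _ (by omega), hmain.congr_right ?_,
    hmain.congr_right ?_⟩
  · filter_upwards [eventually_gt_atTop 0] with n hn
    have hn' : (0 : ℝ) < n := by exact_mod_cast hn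
    rw [modularScale, mul_div_left_comm, hsqrt hn, Real.rpow_def_of_pos hn' ((n : ℝ) / 6)]
    have e : (n : ℝ) / 6 * (Real.log n - 1) + (n : ℝ) ^ (1 / 2 : ℝ) + (n : ℝ) ^ (1 / 3 : ℝ) =
        Real.log n * (n / 6) +
          (-((n : ℝ) / 6) + (n : ℝ) ^ (1 / 2 : ℝ) + (n : ℝ) ^ (1 / 3 : ℝ)) := by ring
    rw [e, Real.exp_add]
    ring
  · filter_upwards [eventually_gt_atTop 0] with n hn
    have hn' : (0 : ℝ) < n := by exact_mod_cast hn
    have hc : (12 * Real.pi * Real.exp (1 / 2)) ^ (-(1 / 2) : ℝ) =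
        Real.exp (-(1 / 4)) / √(12 * Real.pi) := by
      rw [Real.mul_rpow (by positivity) (Real.exp_nonneg _), ← Real.exp_mul,
        Real.rpow_neg (by positivity), ← Real.sqrt_eq_rpow, mul_comm, ← div_eq_mul_inv]
      norm_num
    have hp : (n : ℝ) / √n = Real.exp (1 / 2 * Real.log n) := by
      rw [hsqrt hn, Real.rpow_def_of_pos hn', mul_comm]
    rw [hc, modularScale, mul_div_left_comm, hp, ← Real.exp_add]
    congr 2
    ring
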